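/- Let $D_1,\dots,D_p$ be finitely many pairwise disjoint closed round discs, of radii $R_1,\dots,R_p>0$, in the flat torus $T^2=\mathbb R^2/\mathbb Z^2$, and let $\beta_1,\dots,\beta_p>0$ be inverse temperatures assigned to them. Put $\Gamma=T^2\setminus\bigcup_i D_i$ and assume bounded horizon: the lengths of straight collision-free paths are bounded (tangential collisions count as collisions). Let $\Omega=\partial\Gamma\times[0,\infty)$. Consider the Markov chain on $\Omega$ with the following transition from $(r,v_\perp)$, $r\in\partial D_i$: draw a tangential velocity $v_t$ from the law $\sqrt{\beta_i/\pi}\,e^{-\beta_i v_t^2}\,dv_t$; the particle leaves $r$ into $\Gamma$ with normal velocity $v_\perp$ and tangential velocity $v_t$ and flies freely to its next collision point $r'\in\partial\Gamma$; the new state is $(r',v_\perp')$, where $v_\perp'$ is the absolute value of the normal component of its velocity at $r'$. Let $\mathcal P((r,v_\perp),\cdot)$ be the transition kernel and $(\mathcal P^*f)(r,v_\perp)=\int_\Omega f\,d\mathcal P((r,v_\perp),\cdot)$ for $f:\Omega\to[0,\infty]$. Then there are $0<\epsilon<\min_i\beta_i$, $0<v_\perp^{\min}<v_\perp^{\max}$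 and $A$ with $e^{\epsilon (v_\perp^{\max})^2}=(v_\perp^{\min})^{-1}=A$, and constants $\gamma\in(0,1)$ and $0<K<\infty$, such that the function $$V(r,v_\perp)=\begin{cases} v_\perp^{-1}, & v_\perp<v_\perp^{\min},\\ A, & v_\perp^{\min}\le v_\perp\le v_\perp^{\max},\\ e^{\epsilon v_\perp^2}, & v_\perp>v_\perp^{\max}\end{cases}$$ (finite for $v_\perp>0$, with $V(r,0)=+\infty$) satisfies $$\mathcal P^*V(r,v_\perp)\le\gamma V(r,v_\perp)+K\qquad\text{for all }(r,v_\perp)\in\Omega .$$ Moreover, for all $r\in\partial D_i$ and all $v_\perp>0$, $$\mathcal P^*V(r,v_\perp)=\int_{-\pi/2}^{\pi/2}V(r',v_\perp')\,\rho_{v_\perp}(\varphi;\beta_i)\,d\varphi,\qquad \rho_{v_\perp}(\varphi;\beta_i)=\sqrt{\frac{\beta_i}{\pi}}\,\frac{v_\perp}{\cos^2\varphi}\,e^{-\beta_i v_\perp^2\tan^2\varphi},$$ where $(r',v_\perp')$ is the next collision state when the particle leaves $r$ at the angle $\varphi$ to the normal with normal velocity $v_\perp$. -/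

import Mathlib

open MeasureTheory

noncomputable section

/-- The vector of the lattice `ℤ²` with integer coordinates `m`, in the plane `ℂ = ℝ²`. -/
def latticeVec (m : ℤ × ℤ) : ℂ := (m.1 : ℂ) + (m.2 : ℂ) * Complex.I

/-- Finitely many pairwise disjoint closed discs in the flat torus `T² = ℂ / ℤ²`, each with an
inverse temperature.  A disc is given by a lift of its centre to the plane; the lifted discs are
all the lattice translates, and these are pairwise disjoint (so each disc is embedded in the torus,
and different discs do not meet there). -/
structure ThermostatTable (p : ℕ) where
  center : Fin p → ℂ
  radius : Fin p → ℝ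
  beta : Fin p → ℝ
  radius_pos : ∀ i, 0 < radius i
  beta_pos : ∀ i, 0 < beta i
  disjoint : ∀ (i j : Fin p) (m n : ℤ × ℤ), (i, m) ≠ (j, n) →
    Disjoint (Metric.closedBall (center i + latticeVec m) (radius i))
      (Metric.closedBall (center j + latticeVec n) (radius j))

/-- The boundary `∂Γ` is the disjoint union of the circles `∂D_i`.  The pair `(i, n)` stands for the
point of `∂D_i` at which the unit normal pointing out of `D_i` (into `Γ`) is `n`. -/
abbrev BoundaryPoint (p : ℕ) : Type := Fin p × Circle

/-- The unit circle carries its Borel σ-algebra. -/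
instance : MeasurableSpace Circle := borel Circle

instance : BorelSpace Circle := ⟨rfl⟩

/-- The phase space `Ω = ∂Γ × [0, ∞)` of the collision chain: the collision point and the absolute
value of the normal velocity. -/
abbrev PhaseSpace (p : ℕ) : Type := BoundaryPoint p × NNReal

namespace ThermostatTable

variable {p : ℕ} (T : ThermostatTable p)

/-- The union of all lifted discs: the preimage in the plane of `⋃ D_i ⊆ T²`. -/
def obstacles : Set ℂ :=
  ⋃ (i : Fin p) (m : ℤ × ℤ), Metric.closedBall (T.center i + latticeVec m) (T.radius i)

/-- The lengths of collision-free straight paths are bounded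
(tangential collisions count as collisions). -/
def BoundedHorizon : Prop :=
  ∃ L : ℝ, ∀ z u : ℂ, ‖u‖ = 1 → ∃ t ∈ Set.Icc (0 : ℝ) L, z + (t : ℂ) * u ∈ T.obstacles

/-- A lift to the plane of a point of `∂Γ`. -/
def lift (r : BoundaryPoint p) : ℂ := T.center r.1 + (T.radius r.1 : ℂ) * (r.2 : ℂ)

/-- A particle leaving `r` with velocity `w` flies freely during the time interval `(0, t)` and
collides at time `t > 0` at the point `r'`. -/
def NextCollision (r : BoundaryPoint p) (w : ℂ) (t : ℝ) (r' : BoundaryPoint p) : Prop :=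
  0 < t ∧ (∀ s ∈ Set.Ioo (0 : ℝ) t, T.lift r + (s : ℂ) * w ∉ T.obstacles) ∧
    ∃ m : ℤ × ℤ, T.lift r + (t : ℂ) * w = T.lift r' + latticeVec m

open Classical in
/-- The point of the next collision of a particle leaving `r` with velocity `w`.  (It is unique
whenever it exists; if there is none, for example when `w = 0`, the value is `r`.) -/
def nextPoint (r : BoundaryPoint p) (w : ℂ) : BoundaryPoint p :=
  if h : ∃ r' : BoundaryPoint p, ∃ t : ℝ, T.NextCollision r w t r' then h.choose else r

/-- The next point of the phase space: the point `r'` of the next collision, and the absolute value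
of the component of the velocity `w` normal to the boundary there. -/
def nextState (r : BoundaryPoint p) (w : ℂ) : PhaseSpace p :=
  (T.nextPoint r w, ‖inner ℝ ((T.nextPoint r w).2 : ℂ) w‖₊)

/-- The velocity after the collision `(r, v⊥)` if the new tangential component is `vt`;
the normal `n` and the tangent `i n` are an orthonormal basis. -/
def outVelocity (x : PhaseSpace p) (vt : ℝ) : ℂ :=
  ((x.2 : ℝ) : ℂ) * (x.1.2 : ℂ) + (vt : ℂ) * (Complex.I * (x.1.2 : ℂ))

/-- The velocity after the collision `(r, v⊥)` if the particle leaves at the angle `φ` to the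
normal: its speed is `v⊥ / cos φ`. -/
def outVelocityAngle (x : PhaseSpace p) (φ : ℝ) : ℂ :=
  (((x.2 : ℝ) / Real.cos φ : ℝ) : ℂ) * Complex.exp ((φ : ℂ) * Complex.I) * (x.1.2 : ℂ)

/-- The law `√(β/π) exp(-β vt²) dvt` of the tangential velocity handed out by a thermostat. -/
def tangentialLaw (β : ℝ) : Measure ℝ :=
  volume.withDensity fun vt => ENNReal.ofReal (Real.sqrt (β / Real.pi) * Real.exp (-β * vt ^ 2))

/-- The transition probability `𝒫((r, v⊥), ·)` of the collision chain: draw the tangential velocity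
from the law of the thermostat that carries `r`, and move to the next collision. -/
def transition (x : PhaseSpace p) : Measure (PhaseSpace p) :=
  (tangentialLaw (T.beta x.1.1)).map fun vt => T.nextState x.1 (outVelocity x vt)

/-- The operator `(𝒫* f)(x) = ∫ f(y) 𝒫(x, dy)` on functions with values in `[0, ∞]`. -/
def pullback (f : PhaseSpace p → ENNReal) (x : PhaseSpace p) : ENNReal :=
  ∫⁻ y, f y ∂(T.transition x)

/-- The density `ρ_{v⊥}(φ; β)` of the outgoing angle. -/
def angleDensity (β v φ : ℝ) : ℝ :=
  Real.sqrt (β / Real.pi) * (v / Real.cos φ ^ 2) * Real.exp (-β * v ^ 2 * Real.tan φ ^ 2)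

/-- The potential: `v⊥⁻¹` for `v⊥ < vmin` (with the value `∞` at `v⊥ = 0`), the constant `A` for
`vmin ≤ v⊥ ≤ vmax`, and `exp(ε v⊥²)` for `v⊥ > vmax`. -/
def potential (ε vmin vmax A : ℝ) (x : PhaseSpace p) : ENNReal :=
  if (x.2 : ℝ) < vmin then (x.2 : ENNReal)⁻¹
  else if (x.2 : ℝ) ≤ vmax then ENNReal.ofReal A
  else ENNReal.ofReal (Real.exp (ε * (x.2 : ℝ) ^ 2))

end ThermostatTable

end

/-! The potential is comparable, up to additive constants, to the sum of exp(ε v⊥²) and 1/v⊥, so a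
drift estimate for each of the two suffices.

High speeds (`exists_lintegral_exp_le`). A particle leaves with velocity w, normal speed v and
tangential speed u, and hits a disc of radius R whose centre is at X from the starting point. Its
new tangential speed is |det(X, w)|/R, an affine function of u. For a nearly central hit by a nearly
normal particle its slope exceeds 1 uniformly, because the gap between discs puts the centre farther
away than R. Only one disc can be hit in this way (`GeometryBounds.eq_of_central`), so the zero s of
the affine function depends on the starting state alone. Hence v'² ≤ v² + u² - κ(u - s)² with κ > 1,
and the Gaussian integral of exp(ε v'²) is at most exp(ε v²) √(β/(β + ε(κ - 1))), a contraction.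
Otherwise u is large or a fixed share of v² is lost (`exists_normal_speed_bound`), and the
contribution is exponentially smaller.

Low speeds (`exists_lintegral_inv_le`). Near a grazing direction v' vanishes like the square root of
the angle, so 1/v' has singularities of order 1/2 in φ, from finitely many discs. Interpolating the
angular density costs a further cos^(-1/4) and leaves the factor (1 + 1/(√β v))^(3/4). The combined
singularities of order 3/4 are integrable, uniformly in their position, and growth sublinear in 1/v
is absorbed into 1/(2v) plus a constant. -/

namespace ThermostatTable

variable {p : ℕ} (T : ThermostatTable p)

/-! ### Plane geometry and uniform constants of the table -/

/-- The oriented area `det (X, w)`. -/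
noncomputable def cross (X w : ℂ) : ℝ := inner ℝ (Complex.I * X) w

theorem inner_eq_re_im (X w : ℂ) : inner ℝ X w = X.re * w.re + X.im * w.im := by
  rw [Complex.inner]; simp; ring

theorem cross_eq_re_im (X w : ℂ) : cross X w = X.re * w.im - X.im * w.re := by
  rw [cross, inner_eq_re_im]; simp; ring

theorem normSq_eq_re_im (X : ℂ) : ‖X‖ ^ 2 = X.re ^ 2 + X.im ^ 2 := by
  rw [Complex.sq_norm, Complex.normSq_apply]; ring

theorem inner_sq_add_cross_sq (X w : ℂ) :
    inner ℝ X w ^ 2 + cross X w ^ 2 = ‖X‖ ^ 2 * ‖w‖ ^ 2 := by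
  rw [inner_eq_re_im, cross_eq_re_im, normSq_eq_re_im, normSq_eq_re_im]; ring

theorem abs_cross_le (X w : ℂ) : |cross X w| ≤ ‖X‖ * ‖w‖ := by
  have := abs_real_inner_le_norm (Complex.I * X) w
  simpa [cross] using this

/-- The centres of the lifted discs. -/
def discCenter (k : Fin p × ℤ × ℤ) : ℂ := T.center k.1 + latticeVec k.2

theorem mem_obstacles {z : ℂ} :
    z ∈ T.obstacles ↔ ∃ k : Fin p × ℤ × ℤ, ‖z - T.discCenter k‖ ≤ T.radius k.1 := by
  simp [obstacles, discCenter, dist_eq_norm]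

theorem latticeVec_sub (m n : ℤ × ℤ) : latticeVec (m - n) = latticeVec m - latticeVec n := by
  simp [latticeVec]; ring

theorem finite_latticeVec_norm_le (B : ℝ) : {m : ℤ × ℤ | ‖latticeVec m‖ ≤ B}.Finite := by
  refine Set.Finite.subset (Set.finite_Icc ((-⌈B⌉, -⌈B⌉) : ℤ × ℤ) (⌈B⌉, ⌈B⌉)) ?_
  intro m hm
  have h1 := (Complex.abs_re_le_norm (latticeVec m)).trans hm
  have h2 := (Complex.abs_im_le_norm (latticeVec m)).trans hm
  simp only [latticeVec, Complex.add_re, Complex.mul_re, Complex.intCast_re, Complex.intCast_im,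
    Complex.I_re, Complex.I_im, Complex.add_im, Complex.mul_im] at h1 h2
  have h3 := abs_le.1 h1
  have h4 := abs_le.1 h2
  have h5 := Int.le_ceil B
  refine ⟨Prod.mk_le_mk.2 ⟨?_, ?_⟩, Prod.mk_le_mk.2 ⟨?_, ?_⟩⟩ <;>
    · rw [← Int.cast_le (R := ℝ)]; push_cast; linarith

theorem exists_radius_bounds : ∃ a B : ℝ, 0 < a ∧ a ≤ B ∧ ∀ i, a ≤ T.radius i ∧ T.radius i ≤ B := by
  have h1 : ∀ᶠ a in nhdsWithin (0 : ℝ) (Set.Ioi 0), ∀ i, a ≤ T.radius i :=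
    Filter.eventually_all.2 fun i =>
      (Filter.eventually_of_mem (Ioc_mem_nhdsGT (T.radius_pos i)) fun _ h => h.2)
  obtain ⟨a, ha, ha0⟩ := (h1.and self_mem_nhdsWithin).exists
  have h2 : ∀ᶠ B in Filter.atTop, ∀ i, T.radius i ≤ B :=
    Filter.eventually_all.2 fun i => Filter.eventually_ge_atTop _
  obtain ⟨B, hB, hB0⟩ := (h2.and (Filter.eventually_ge_atTop a)).exists
  exact ⟨a, B, ha0, hB0, fun i => ⟨ha i, hB i⟩⟩

theorem exists_norm_center_le : ∃ B : ℝ, 0 < B ∧ ∀ i, ‖T.center i‖ ≤ B := by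
  have h2 : ∀ᶠ B in Filter.atTop, ∀ i, ‖T.center i‖ ≤ B :=
    Filter.eventually_all.2 fun i => Filter.eventually_ge_atTop _
  obtain ⟨B, hB, hB0⟩ := (h2.and (Filter.eventually_gt_atTop 0)).exists
  exact ⟨B, hB0, hB⟩

theorem finite_discCenter_norm_le (B : ℝ) : {k | ‖T.discCenter k‖ ≤ B}.Finite := by
  obtain ⟨C, -, hC⟩ := T.exists_norm_center_le
  refine Set.Finite.subset (Set.finite_univ.prod (finite_latticeVec_norm_le (B + C))) ?_
  rintro ⟨i, m⟩ h
  refine ⟨trivial, ?_⟩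
  have : latticeVec m = T.discCenter (i, m) - T.center i := by simp [discCenter]
  rw [Set.mem_ofPred_eq, this]
  exact (norm_sub_le _ _).trans (add_le_add h (hC i))

theorem radius_add_lt_dist {k l : Fin p × ℤ × ℤ} (h : k ≠ l) :
    T.radius k.1 + T.radius l.1 < ‖T.discCenter k - T.discCenter l‖ := by
  rw [← dist_eq_norm]
  exact (disjoint_closedBall_closedBall_iff (T.radius_pos _).le (T.radius_pos _).le).1
    (T.disjoint k.1 l.1 k.2 l.2 h)

/-- By translation one disc may be taken in the base cell. Only finitely many discs are then close
to it, and all others are separated from it by more than 1 ≥ g. -/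
theorem exists_gap : ∃ g : ℝ, 0 < g ∧ ∀ k l, k ≠ l →
    T.radius k.1 + T.radius l.1 + g ≤ ‖T.discCenter k - T.discCenter l‖ := by
  obtain ⟨a, B, ha, -, hB⟩ := T.exists_radius_bounds
  obtain ⟨C, -, hC⟩ := T.exists_norm_center_le
  have hfin := (Set.finite_univ (α := Fin p)).prod (T.finite_discCenter_norm_le (B + B + 1 + C))
  have h1 : ∀ᶠ g in nhdsWithin (0 : ℝ) (Set.Ioi 0), ∀ q ∈
      (Set.univ (α := Fin p) ×ˢ {k | ‖T.discCenter k‖ ≤ B + B + 1 + C}),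
      (q.1, 0) ≠ q.2 → T.radius q.1 + T.radius q.2.1 + g ≤
        ‖T.discCenter (q.1, 0) - T.discCenter q.2‖ := by
    refine (Filter.eventually_all_finite hfin).2 fun q _ => ?_
    by_cases hq : (q.1, 0) = q.2
    · exact Filter.Eventually.of_forall fun _ h => absurd hq h
    · have := T.radius_add_lt_dist hq
      refine Filter.eventually_of_mem (Ioc_mem_nhdsGT (sub_pos.2 this)) fun g hg _ => ?_
      have := hg.2
      simp only at this ⊢
      linarith
  obtain ⟨g, ⟨hg, hg0⟩, hg1⟩ := ((h1.and self_mem_nhdsWithin).and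
    (Filter.eventually_of_mem (Ioc_mem_nhdsGT zero_lt_one) fun _ h => h.2)).exists
  refine ⟨g, hg0, fun k l hkl => ?_⟩
  have e : T.discCenter k - T.discCenter l =
      T.discCenter (k.1, 0) - T.discCenter (l.1, l.2 - k.2) := by
    simp only [discCenter, latticeVec_sub]
    have : latticeVec 0 = 0 := by simp [latticeVec]
    rw [this]; ring
  rw [e]
  by_cases hn : ‖T.discCenter (l.1, l.2 - k.2)‖ ≤ B + B + 1 + C
  · refine hg (k.1, (l.1, l.2 - k.2)) ⟨trivial, hn⟩ fun h => hkl ?_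
    simp only [Prod.mk.injEq] at h
    exact Prod.ext h.1 (sub_eq_zero.1 h.2.symm).symm
  · push Not at hn
    have h2 : ‖T.discCenter (k.1, 0)‖ ≤ C := by simpa [discCenter, latticeVec] using hC k.1
    have h3 := norm_sub_norm_le (T.discCenter (l.1, l.2 - k.2)) (T.discCenter (k.1, 0))
    rw [norm_sub_rev] at h3
    have h4 := (hB k.1).2
    have h5 := (hB l.1).2
    linarith

theorem isClosed_obstacles : IsClosed T.obstacles := by
  have : T.obstacles = ⋃ k : Fin p × ℤ × ℤ, Metric.closedBall (T.discCenter k) (T.radius k.1) := by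
    ext z; simp [mem_obstacles, dist_eq_norm]
  rw [this]
  obtain ⟨a, B, ha, -, hB⟩ := T.exists_radius_bounds
  refine LocallyFinite.isClosed_iUnion (fun z => ⟨Metric.ball z 1,
    Metric.ball_mem_nhds z one_pos, ?_⟩) fun k => Metric.isClosed_closedBall
  refine (T.finite_discCenter_norm_le (B + 1 + ‖z‖)).subset ?_
  rintro k ⟨y, hy1, hy2⟩
  rw [Metric.mem_closedBall, dist_eq_norm] at hy1
  rw [Metric.mem_ball, dist_eq_norm] at hy2
  have h1 := (hB k.1).2
  have h2 : T.discCenter k = (y - z) - (y - T.discCenter k) + z := by ring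
  rw [Set.mem_ofPred_eq, h2]
  have h3 := norm_add_le ((y - z) - (y - T.discCenter k)) z
  have h4 := norm_sub_le (y - z) (y - T.discCenter k)
  linarith

/-! ### Existence of the next collision -/

theorem normSq_add_ofReal_mul (X w : ℂ) (t : ℝ) :
    ‖X + t * w‖ ^ 2 = ‖X‖ ^ 2 + 2 * t * inner ℝ X w + t ^ 2 * ‖w‖ ^ 2 := by
  simp only [normSq_eq_re_im, inner_eq_re_im, Complex.add_re, Complex.add_im, Complex.mul_re,
    Complex.mul_im, Complex.ofReal_re, Complex.ofReal_im]
  ring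

theorem lift_sub_discCenter (r : BoundaryPoint p) :
    T.lift r - T.discCenter (r.1, 0) = T.radius r.1 * (r.2 : ℂ) := by
  simp [lift, discCenter, latticeVec]

theorem norm_lift_sub_discCenter (r : BoundaryPoint p) :
    ‖T.lift r - T.discCenter (r.1, 0)‖ = T.radius r.1 := by
  rw [lift_sub_discCenter]
  simp [abs_of_pos (T.radius_pos _), Circle.norm_coe]

/-- The lift of a boundary point keeps a distance from the other discs. -/
theorem radius_add_le_norm_sub_lift {g : ℝ} (hg : ∀ k l, k ≠ l →
    T.radius k.1 + T.radius l.1 + g ≤ ‖T.discCenter k - T.discCenter l‖)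
    (r : BoundaryPoint p) {k : Fin p × ℤ × ℤ} (hk : k ≠ (r.1, 0)) :
    T.radius k.1 + g ≤ ‖T.discCenter k - T.lift r‖ := by
  have h1 := hg k (r.1, 0) hk
  have h2 := T.norm_lift_sub_discCenter r
  have h3 := norm_add_le (T.discCenter k - T.lift r) (T.lift r - T.discCenter (r.1, 0))
  rw [sub_add_sub_cancel] at h3
  simp only at h1
  linarith

/-- A particle moving away from a disc does not meet it again. -/
theorem radius_lt_norm_of_outgoing (r : BoundaryPoint p) {w : ℂ}
    (hw : 0 < inner ℝ (r.2 : ℂ) w) {s : ℝ} (hs : 0 < s) :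
    T.radius r.1 < ‖T.lift r + s * w - T.discCenter (r.1, 0)‖ := by
  have hR := T.radius_pos r.1
  refine lt_of_pow_lt_pow_left₀ 2 (norm_nonneg _) ?_
  have e : T.lift r + s * w - T.discCenter (r.1, 0) = T.radius r.1 * (r.2 : ℂ) + s * w := by
    rw [← lift_sub_discCenter]; ring
  rw [e, normSq_add_ofReal_mul]
  have h1 : inner ℝ ((T.radius r.1 : ℂ) * (r.2 : ℂ)) w =
      T.radius r.1 * inner ℝ (r.2 : ℂ) w := by
    simp only [inner_eq_re_im, Complex.mul_re, Complex.mul_im, Complex.ofReal_re,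
      Complex.ofReal_im]; ring
  have h2 : ‖(T.radius r.1 : ℂ) * (r.2 : ℂ)‖ = T.radius r.1 := by
    simp [abs_of_pos hR, Circle.norm_coe]
  rw [h1, h2]
  have h3 : 0 < 2 * s * (T.radius r.1 * inner ℝ (r.2 : ℂ) w) := by positivity
  have h4 : 0 ≤ s ^ 2 * ‖w‖ ^ 2 := by positivity
  linarith

theorem ne_zero_of_inner_pos {n w : ℂ} (hw : 0 < inner ℝ n w) : w ≠ 0 := by
  rintro rfl; simp at hw

theorem exists_nextCollision (hT : T.BoundedHorizon) (r : BoundaryPoint p) {w : ℂ}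
    (hw : 0 < inner ℝ (r.2 : ℂ) w) : ∃ r' t, T.NextCollision r w t r' := by
  obtain ⟨L, hL⟩ := hT
  obtain ⟨g, hg, hgap⟩ := T.exists_gap
  have hw0 : 0 < ‖w‖ := norm_pos_iff.2 (ne_zero_of_inner_pos hw)
  -- The time needed to travel half the gap: until then no other disc is reached, and the disc just
  -- left is not met again.
  set d : ℝ := g / 2 / ‖w‖ with hd
  have hdpos : 0 < d := by positivity
  have hdw : d * ‖w‖ = g / 2 := by rw [hd]; field_simp
  have hfree : ∀ s : ℝ, 0 < s → s ≤ d → T.lift r + (s : ℂ) * w ∉ T.obstacles := by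
    intro s hs hsd hmem
    obtain ⟨k, hk⟩ := T.mem_obstacles.1 hmem
    by_cases hk0 : k = (r.1, 0)
    · subst hk0
      exact absurd hk (not_le.2 (T.radius_lt_norm_of_outgoing r hw hs))
    · have h1 := T.radius_add_le_norm_sub_lift hgap r hk0
      have h2 : T.discCenter k - T.lift r =
        (s : ℂ) * w - (T.lift r + s * w - T.discCenter k) := by ring
      have h3 := norm_sub_le ((s : ℂ) * w) (T.lift r + s * w - T.discCenter k)
      rw [← h2, norm_mul, Complex.norm_real, Real.norm_of_nonneg hs.le] at h3
      have h4 : s * ‖w‖ ≤ d * ‖w‖ := by gcongr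
      linarith
  -- The starting point is itself an obstacle point, so bounded horizon is informative only from a
  -- later point of the ray.
  obtain ⟨t₁, ht₁, hmem₁⟩ := hL (T.lift r + d * w) ((‖w‖⁻¹ : ℝ) * w) (by
    rw [norm_mul, Complex.norm_real, norm_inv, norm_norm, inv_mul_cancel₀ hw0.ne'])
  set S : Set ℝ := Set.Icc d (d + t₁ * ‖w‖⁻¹) ∩
    (fun s : ℝ => T.lift r + (s : ℂ) * w) ⁻¹' T.obstacles with hS
  have hScomp : IsCompact S :=
    isCompact_Icc.inter_right (T.isClosed_obstacles.preimage (by fun_prop))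
  have hSne : S.Nonempty := by
    refine ⟨d + t₁ * ‖w‖⁻¹, ⟨?_, le_rfl⟩, ?_⟩
    · have : 0 ≤ t₁ * ‖w‖⁻¹ := mul_nonneg ht₁.1 (by positivity)
      linarith
    · have e : T.lift r + ((d + t₁ * ‖w‖⁻¹ : ℝ) : ℂ) * w =
        T.lift r + d * w + t₁ * ((‖w‖⁻¹ : ℝ) * w) := by push_cast; ring
      rw [Set.mem_preimage, e]; exact hmem₁
  obtain ⟨t, htS, htmin⟩ := hScomp.exists_isLeast hSne
  have ht0 : 0 < t := hdpos.trans_le htS.1.1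
  have hfree' : ∀ s ∈ Set.Ioo (0 : ℝ) t, T.lift r + (s : ℂ) * w ∉ T.obstacles := by
    rintro s ⟨hs0, hst⟩ hmem
    rcases le_or_gt s d with h | h
    · exact hfree s hs0 h hmem
    · exact absurd (htmin ⟨⟨h.le, hst.le.trans htS.1.2⟩, hmem⟩) (not_le.2 hst)
  obtain ⟨k, hk⟩ := T.mem_obstacles.1 htS.2
  -- A point inside the disc would have obstacle points just before it on the ray.
  have hkeq : ‖T.lift r + t * w - T.discCenter k‖ = T.radius k.1 := by
    refine le_antisymm hk (not_lt.1 fun hlt => ?_)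
    have hc : Continuous fun s : ℝ => ‖T.lift r + (s : ℂ) * w - T.discCenter k‖ := by fun_prop
    have hev : ∀ᶠ s : ℝ in nhdsWithin t (Set.Iio t),
        ‖T.lift r + (s : ℂ) * w - T.discCenter k‖ < T.radius k.1 :=
      (hc.tendsto t).eventually_lt_const hlt |>.filter_mono nhdsWithin_le_nhds
    obtain ⟨s, hs, hs'⟩ := (hev.and (Ioo_mem_nhdsLT ht0)).exists
    exact hfree' s hs' (T.mem_obstacles.2 ⟨k, hs.le⟩)
  have hR := T.radius_pos k.1
  have hunit : ‖(T.lift r + t * w - T.discCenter k) / (T.radius k.1 : ℂ)‖ = 1 := by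
    rw [norm_div, hkeq, Complex.norm_real, Real.norm_of_nonneg hR.le, div_self hR.ne']
  refine ⟨(k.1, ⟨_, mem_sphere_zero_iff_norm.2 hunit⟩), t, ht0, hfree', k.2, ?_⟩
  have hRC : (T.radius k.1 : ℂ) ≠ 0 := by exact_mod_cast hR.ne'
  simp only [lift, discCenter]
  rw [mul_div_cancel₀ _ hRC]
  ring

/-! ### First hits: energy balance and order of the discs along a ray -/

/-- The ray from `z` with velocity `w` first meets a disc at time `t`, namely the disc `k`, at the
point with outer normal `n`. -/
structure FirstHit (z w : ℂ) (t : ℝ) (k : Fin p × ℤ × ℤ) (n : ℂ) : Prop where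
  pos : 0 < t
  free : ∀ s ∈ Set.Ioo (0 : ℝ) t, z + (s : ℂ) * w ∉ T.obstacles
  norm_normal : ‖n‖ = 1
  eq : z + (t : ℂ) * w = T.discCenter k + T.radius k.1 * n

theorem exists_firstHit (hT : T.BoundedHorizon) (r : BoundaryPoint p) {w : ℂ}
    (hw : 0 < inner ℝ (r.2 : ℂ) w) :
    ∃ t k, T.FirstHit (T.lift r) w t k (T.nextPoint r w).2 ∧ k.1 = (T.nextPoint r w).1 ∧
      k ≠ (r.1, 0) := by
  have h := T.exists_nextCollision hT r hw
  obtain ⟨t, ht, hfree, m, hm⟩ := h.choose_spec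
  have e : T.nextPoint r w = h.choose := by rw [nextPoint, dif_pos h]
  rw [← e] at hm
  have hit : T.FirstHit (T.lift r) w t ((T.nextPoint r w).1, m) (T.nextPoint r w).2 :=
    ⟨ht, hfree, Circle.norm_coe _, by rw [hm]; simp only [lift, discCenter]; ring⟩
  refine ⟨t, _, hit, rfl, fun hk => ?_⟩
  have h1 := T.radius_lt_norm_of_outgoing r hw ht
  rw [← hk, hit.eq, add_sub_cancel_left, norm_mul, hit.norm_normal, mul_one, Complex.norm_real,
    Real.norm_of_nonneg (T.radius_pos _).le, hk] at h1
  exact lt_irrefl _ h1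

namespace FirstHit

variable {T} {z w n : ℂ} {t : ℝ} {k : Fin p × ℤ × ℤ}

theorem cross_eq (h : T.FirstHit z w t k n) :
    T.radius k.1 * cross n w = - cross (T.discCenter k - z) w := by
  have e : T.discCenter k - z = t * w - T.radius k.1 * n := by linear_combination -h.eq
  rw [e]
  simp only [cross_eq_re_im, Complex.sub_re, Complex.sub_im, Complex.mul_re, Complex.mul_im,
    Complex.ofReal_re, Complex.ofReal_im]
  ring

/-- Otherwise the particle would have been inside disc `k` just before time `t`. -/
theorem inner_normal_nonpos (h : T.FirstHit z w t k n) : inner ℝ n w ≤ 0 := by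
  by_contra! hpos
  have hR := T.radius_pos k.1
  have ht := h.pos
  have hev : ∀ᶠ s in nhdsWithin (0 : ℝ) (Set.Ioi 0),
      s * ‖w‖ ^ 2 - 2 * T.radius k.1 * inner ℝ n w < 0 := by
    have hc : Continuous fun s : ℝ => s * ‖w‖ ^ 2 - 2 * T.radius k.1 * inner ℝ n w := by fun_prop
    refine ((hc.tendsto 0).eventually_lt_const ?_).filter_mono nhdsWithin_le_nhds
    have : 0 < 2 * T.radius k.1 * inner ℝ n w := by positivity
    linarith
  obtain ⟨s, hs, hs0, hst⟩ := (hev.and (Ioo_mem_nhdsGT ht)).exists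
  refine h.free (t - s) ⟨by linarith, by linarith⟩ (T.mem_obstacles.2 ⟨k, ?_⟩)
  refine le_of_sq_le_sq ?_ hR.le
  have e : z + ((t - s : ℝ) : ℂ) * w - T.discCenter k =
      T.radius k.1 * n + ((-s : ℝ) : ℂ) * w := by
    push_cast
    linear_combination h.eq
  have h1 : inner ℝ ((T.radius k.1 : ℂ) * n) w = T.radius k.1 * inner ℝ n w := by
    simp only [inner_eq_re_im, Complex.mul_re, Complex.mul_im, Complex.ofReal_re,
      Complex.ofReal_im]; ring
  rw [e, normSq_add_ofReal_mul, h1, norm_mul, h.norm_normal, Complex.norm_real,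
    Real.norm_of_nonneg hR.le]
  nlinarith

theorem inner_center_pos (h : T.FirstHit z w t k n) (hw : w ≠ 0) :
    0 < inner ℝ (T.discCenter k - z) w := by
  have e : T.discCenter k - z = t * w - T.radius k.1 * n := by linear_combination -h.eq
  have h1 : inner ℝ (T.discCenter k - z) w = t * ‖w‖ ^ 2 - T.radius k.1 * inner ℝ n w := by
    rw [e]
    simp only [normSq_eq_re_im, inner_eq_re_im, Complex.sub_re, Complex.sub_im, Complex.mul_re,
      Complex.mul_im, Complex.ofReal_re, Complex.ofReal_im]
    ring
  have h2 := mul_nonneg (T.radius_pos k.1).le (neg_nonneg.2 h.inner_normal_nonpos)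
  have h3 : 0 < t * ‖w‖ ^ 2 := mul_pos h.pos (by have := norm_pos_iff.2 hw; positivity)
  rw [h1]; linarith

theorem inner_normal_sq (h : T.FirstHit z w t k n) :
    inner ℝ n w ^ 2 = ‖w‖ ^ 2 - (cross (T.discCenter k - z) w / T.radius k.1) ^ 2 := by
  have h1 := inner_sq_add_cross_sq n w
  have h2 : cross (T.discCenter k - z) w / T.radius k.1 = - cross n w := by
    have := (T.radius_pos k.1).ne'
    field_simp
    linarith [h.cross_eq]
  rw [h.norm_normal] at h1
  rw [h2]; linarith

theorem abs_cross_center_le (h : T.FirstHit z w t k n) :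
    |cross (T.discCenter k - z) w| ≤ T.radius k.1 * ‖w‖ := by
  rw [← abs_neg, ← h.cross_eq, abs_mul, abs_of_pos (T.radius_pos k.1)]
  refine mul_le_mul_of_nonneg_left ?_ (T.radius_pos k.1).le
  simpa [h.norm_normal] using abs_cross_le n w

/-- Among the discs met by a ray, the one met first has the foot of its centre first. -/
theorem inner_center_lt (h : T.FirstHit z w t k n) (hw : w ≠ 0) {l : Fin p × ℤ × ℤ} (hl : l ≠ k)
    (hcross : |cross (T.discCenter l - z) w| ≤ T.radius l.1 * ‖w‖)
    (hpos : 0 < inner ℝ (T.discCenter l - z) w) :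
    inner ℝ (T.discCenter k - z) w < inner ℝ (T.discCenter l - z) w := by
  by_contra! hle
  have hw2 : 0 < ‖w‖ ^ 2 := by have := norm_pos_iff.2 hw; positivity
  have hnorm : ∀ (j : Fin p × ℤ × ℤ) (s : ℝ), ‖z + s * w - T.discCenter j‖ ^ 2 * ‖w‖ ^ 2 =
      (s * ‖w‖ ^ 2 - inner ℝ (T.discCenter j - z) w) ^ 2 +
        cross (T.discCenter j - z) w ^ 2 := by
    intro j s
    simp only [normSq_eq_re_im, inner_eq_re_im, cross_eq_re_im, Complex.sub_re, Complex.sub_im,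
      Complex.mul_re, Complex.mul_im, Complex.ofReal_re, Complex.ofReal_im, Complex.add_re,
      Complex.add_im]
    ring
  -- The time of closest approach to the centre of `l`, when the ray is in disc `l`; so `t ≤ s`. As
  -- `s` does not exceed the closest-approach time for `k`, the ray is then also in disc `k`,
  -- contradicting disjointness.
  set s := inner ℝ (T.discCenter l - z) w / ‖w‖ ^ 2 with hs
  have hsw : s * ‖w‖ ^ 2 = inner ℝ (T.discCenter l - z) w := by rw [hs]; field_simp
  have hs0 : 0 < s := by positivity
  have hRl := T.radius_pos l.1
  have hmeml : ‖z + s * w - T.discCenter l‖ ≤ T.radius l.1 := by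
    refine le_of_sq_le_sq (le_of_mul_le_mul_right ?_ hw2) hRl.le
    rw [hnorm, hsw, sub_self, ← mul_pow, ← sq_abs (cross _ _)]
    have := pow_le_pow_left₀ (abs_nonneg _) hcross 2
    linarith
  have hts : t ≤ s := by
    by_contra! hlt
    exact h.free s ⟨hs0, hlt⟩ (T.mem_obstacles.2 ⟨l, hmeml⟩)
  have hRk := T.radius_pos k.1
  have hmemk : ‖z + s * w - T.discCenter k‖ ≤ T.radius k.1 := by
    have hk : ‖z + t * w - T.discCenter k‖ = T.radius k.1 := by
      rw [h.eq, add_sub_cancel_left, norm_mul, h.norm_normal, mul_one, Complex.norm_real,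
        Real.norm_of_nonneg hRk.le]
    rw [← hk]
    refine le_of_sq_le_sq (le_of_mul_le_mul_right ?_ hw2) (norm_nonneg _)
    rw [hnorm, hnorm]
    have h1 : t * ‖w‖ ^ 2 ≤ s * ‖w‖ ^ 2 := by gcongr
    nlinarith
  have h1 := T.radius_add_lt_dist hl
  have h2 := norm_sub_le (z + s * w - T.discCenter k) (z + s * w - T.discCenter l)
  rw [sub_sub_sub_cancel_left] at h2
  linarith

end FirstHit

/-- Free flights from the boundary are bounded in length. -/
theorem exists_flight_bound (hT : T.BoundedHorizon) : ∃ L : ℝ, 0 < L ∧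
    ∀ (z w : ℂ) (t : ℝ) (k : Fin p × ℤ × ℤ) (n : ℂ), w ≠ 0 → T.FirstHit z w t k n →
      ‖T.discCenter k - z‖ ≤ L := by
  obtain ⟨L, hL⟩ := hT
  obtain ⟨a, B, ha, hab, hB⟩ := T.exists_radius_bounds
  have hL0 : 0 ≤ L := by
    obtain ⟨t, ht, -⟩ := hL 0 1 (by simp)
    exact ht.1.trans ht.2
  refine ⟨L + 1 + B, by linarith, fun z w t k n hw h => ?_⟩
  have hw0 : 0 < ‖w‖ := norm_pos_iff.2 hw
  have ht : t * ‖w‖ ≤ L + 1 := by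
    by_contra! hlt
    -- The search starts one unit of length ahead because `z` may lie on an obstacle; this is the 1
    -- in the bound.
    obtain ⟨s, hs, hmem⟩ := hL (z + (‖w‖⁻¹ : ℝ) * w) ((‖w‖⁻¹ : ℝ) * w) (by
      rw [norm_mul, Complex.norm_real, norm_inv, norm_norm, inv_mul_cancel₀ hw0.ne'])
    have e : z + (‖w‖⁻¹ : ℝ) * w + s * ((‖w‖⁻¹ : ℝ) * w) =
      z + (((1 + s) * ‖w‖⁻¹ : ℝ) : ℂ) * w := by push_cast; ring
    rw [e] at hmem
    refine h.free _ ⟨?_, ?_⟩ hmem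
    · have := hs.1; positivity
    · rw [mul_inv_lt_iff₀ hw0]; linarith [hs.2]
  have e : T.discCenter k - z = t * w - T.radius k.1 * n := by linear_combination -h.eq
  rw [e]
  refine (norm_sub_le _ _).trans ?_
  rw [norm_mul, norm_mul, h.norm_normal, Complex.norm_real, Complex.norm_real,
    Real.norm_of_nonneg h.pos.le, Real.norm_of_nonneg (T.radius_pos _).le, mul_one]
  exact add_le_add ht (hB _).2

/-! ### Outgoing velocities and measurability of the collision map -/

theorem circle_re_sq_add_im_sq (n : Circle) : (n : ℂ).re ^ 2 + (n : ℂ).im ^ 2 = 1 := by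
  rw [← normSq_eq_re_im, Circle.norm_coe, one_pow]

theorem inner_outVelocity (x : PhaseSpace p) (u : ℝ) :
    inner ℝ (x.1.2 : ℂ) (outVelocity x u) = x.2 := by
  have := circle_re_sq_add_im_sq x.1.2
  simp only [outVelocity, inner_eq_re_im, Complex.add_re, Complex.add_im, Complex.mul_re,
    Complex.mul_im, Complex.ofReal_re, Complex.ofReal_im, Complex.I_re, Complex.I_im]
  linear_combination (x.2 : ℝ) * this

theorem norm_outVelocity_sq (x : PhaseSpace p) (u : ℝ) :
    ‖outVelocity x u‖ ^ 2 = (x.2 : ℝ) ^ 2 + u ^ 2 := by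
  have := circle_re_sq_add_im_sq x.1.2
  simp only [outVelocity, normSq_eq_re_im, Complex.add_re, Complex.add_im, Complex.mul_re,
    Complex.mul_im, Complex.ofReal_re, Complex.ofReal_im, Complex.I_re, Complex.I_im]
  linear_combination ((x.2 : ℝ) ^ 2 + u ^ 2) * this

theorem outVelocity_ne_zero {x : PhaseSpace p} (hx : 0 < x.2) (u : ℝ) : outVelocity x u ≠ 0 :=
  ne_zero_of_inner_pos ((inner_outVelocity x u).symm ▸ NNReal.coe_pos.2 hx)

theorem cross_outVelocity (X : ℂ) (x : PhaseSpace p) (u : ℝ) :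
    cross X (outVelocity x u) = x.2 * cross X x.1.2 + u * inner ℝ X (x.1.2 : ℂ) := by
  simp only [outVelocity, cross_eq_re_im, inner_eq_re_im, Complex.add_re, Complex.add_im,
    Complex.mul_re, Complex.mul_im, Complex.ofReal_re, Complex.ofReal_im, Complex.I_re,
    Complex.I_im]
  ring

theorem outVelocity_sub (x : PhaseSpace p) (u u' : ℝ) :
    ‖outVelocity x u - outVelocity x u'‖ = |u - u'| := by
  have : outVelocity x u - outVelocity x u' = ((u - u' : ℝ) : ℂ) * (Complex.I * x.1.2) := by
    simp only [outVelocity]; push_cast; ring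
  rw [this]; simp [Circle.norm_coe, -Complex.ofReal_sub]

theorem continuous_outVelocity (x : PhaseSpace p) : Continuous (outVelocity x) := by
  unfold outVelocity; fun_prop

theorem outVelocityAngle_eq (x : PhaseSpace p) {φ : ℝ} (hφ : Real.cos φ ≠ 0) :
    outVelocityAngle x φ = outVelocity x (x.2 * Real.tan φ) := by
  have hφ' : (Real.cos φ : ℂ) ≠ 0 := by exact_mod_cast hφ
  rw [outVelocityAngle, outVelocity, Complex.exp_mul_I, ← Complex.ofReal_cos, ← Complex.ofReal_sin,
    Real.tan_eq_sin_div_cos]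
  push_cast at hφ' ⊢
  field_simp

theorem firstHit_outVelocity (hT : T.BoundedHorizon) {x : PhaseSpace p} (hx : 0 < x.2) (u : ℝ) :
    ∃ t k, T.FirstHit (T.lift x.1) (outVelocity x u) t k (T.nextState x.1 (outVelocity x u)).1.2 ∧
      k.1 = (T.nextState x.1 (outVelocity x u)).1.1 ∧ k ≠ (x.1.1, 0) :=
  T.exists_firstHit hT x.1 ((inner_outVelocity x u).symm ▸ NNReal.coe_pos.2 hx)

theorem nextState_snd (r : BoundaryPoint p) (w : ℂ) :
    ((T.nextState r w).2 : ℝ) = |inner ℝ ((T.nextState r w).1.2 : ℂ) w| := rfl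

theorem eq_of_inner_of_cross {n w : ℂ} (hw : w ≠ 0) :
    n = ((inner ℝ n w : ℝ) - (cross n w : ℝ) * Complex.I) * w / (‖w‖ ^ 2 : ℝ) := by
  have h : ((‖w‖ ^ 2 : ℝ) : ℂ) ≠ 0 := by
    have := norm_ne_zero_iff.2 hw
    exact_mod_cast pow_ne_zero 2 this
  rw [eq_div_iff h, normSq_eq_re_im, inner_eq_re_im, cross_eq_re_im]
  apply Complex.ext <;>
    simp only [Complex.sub_re, Complex.sub_im, Complex.mul_re, Complex.mul_im, Complex.ofReal_re,
      Complex.ofReal_im, Complex.I_re, Complex.I_im] <;> ring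

/-- The state after a collision with the disc `k`, in terms of the velocity. -/
noncomputable def hitState (z w : ℂ) (k : Fin p × ℤ × ℤ) : PhaseSpace p :=
  ((k.1, Circle.exp (Complex.arg
    (((-√(‖w‖ ^ 2 - (cross (T.discCenter k - z) w / T.radius k.1) ^ 2) : ℝ) +
      (cross (T.discCenter k - z) w / T.radius k.1 : ℝ) * Complex.I) * w / (‖w‖ ^ 2 : ℝ)))),
    Real.toNNReal √(‖w‖ ^ 2 - (cross (T.discCenter k - z) w / T.radius k.1) ^ 2))

theorem measurable_hitState (z : ℂ) (k : Fin p × ℤ × ℤ) :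
    Measurable fun w => T.hitState z w k := by
  have hc : Measurable fun w => cross (T.discCenter k - z) w := by
    unfold cross; fun_prop
  refine Measurable.prodMk (Measurable.prodMk measurable_const ?_) ?_
  · refine Circle.exp.continuous.measurable.comp (Complex.measurable_arg.comp ?_)
    fun_prop
  · fun_prop

/-- `nextPoint` is defined by choice, so measurability needs an explicit formula. The disc and `w`
give the tangential component at the hit, energy gives the size of the normal one, and incidence
fixes its sign. -/
theorem nextState_eq_hitState {r : BoundaryPoint p} {w : ℂ} (hw : w ≠ 0) {t : ℝ}
    {k : Fin p × ℤ × ℤ} (h : T.FirstHit (T.lift r) w t k (T.nextState r w).1.2)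
    (hk : k.1 = (T.nextState r w).1.1) : T.nextState r w = T.hitState (T.lift r) w k := by
  set y := T.nextState r w with hy
  have hR := T.radius_pos k.1
  have h1 : inner ℝ (y.1.2 : ℂ) w =
      -√(‖w‖ ^ 2 - (cross (T.discCenter k - T.lift r) w / T.radius k.1) ^ 2) := by
    rw [← h.inner_normal_sq, Real.sqrt_sq_eq_abs, abs_of_nonpos h.inner_normal_nonpos, neg_neg]
  have h2 : cross (y.1.2 : ℂ) w = -(cross (T.discCenter k - T.lift r) w / T.radius k.1) := by
    have := h.cross_eq
    field_simp
    linarith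
  refine Prod.ext (Prod.ext hk.symm ?_) ?_
  · rw [hitState]
    simp only
    rw [← Circle.exp_arg y.1.2]
    congr 2
    rw [eq_of_inner_of_cross (n := (y.1.2 : ℂ)) hw, h1, h2]
    push_cast
    ring
  · apply NNReal.eq
    rw [hitState]
    simp only
    rw [Real.coe_toNNReal _ (Real.sqrt_nonneg _), hy, T.nextState_snd, ← hy, h1, abs_neg,
      abs_of_nonneg (Real.sqrt_nonneg _)]

/-- Countably many measurable pieces `E k` cover the line: the ray meets disc `k` ahead of it (`H
k`), and no disc so met has an earlier foot of its centre. On `E k` the first disc is `k`, and the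
explicit formula applies. -/
theorem measurable_nextState (hT : T.BoundedHorizon) {x : PhaseSpace p} (hx : 0 < x.2) :
    Measurable fun u => T.nextState x.1 (outVelocity x u) := by
  set z := T.lift x.1 with hz
  let H : Fin p × ℤ × ℤ → Set ℝ := fun k =>
    {u | |cross (T.discCenter k - z) (outVelocity x u)| ≤ T.radius k.1 * ‖outVelocity x u‖} ∩
      {u | 0 < inner ℝ (T.discCenter k - z) (outVelocity x u)}
  let E : Fin p × ℤ × ℤ → Set ℝ := fun k => H k ∩ ⋂ l, ((H l)ᶜ ∪
    {u | inner ℝ (T.discCenter k - z) (outVelocity x u) ≤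
      inner ℝ (T.discCenter l - z) (outVelocity x u)})
  have hcont := continuous_outVelocity x
  have hH : ∀ k, MeasurableSet (H k) := by
    intro k
    refine MeasurableSet.inter (measurableSet_le ?_ ?_) (measurableSet_lt ?_ ?_)
    · unfold cross; fun_prop
    all_goals fun_prop
  have hE : ∀ k, MeasurableSet (E k) := fun k =>
    (hH k).inter (MeasurableSet.iInter fun l => (hH l).compl.union
      (measurableSet_le (by fun_prop) (by fun_prop)))
  have hmemH : ∀ {u t k n}, T.FirstHit z (outVelocity x u) t k n → u ∈ H k := fun {u t k n} h =>
    ⟨h.abs_cross_center_le, h.inner_center_pos (outVelocity_ne_zero hx u)⟩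
  have hcover : ∀ u, ∃ k, u ∈ E k := by
    intro u
    obtain ⟨t, k, h, -, -⟩ := T.firstHit_outVelocity hT hx u
    refine ⟨k, hmemH h, Set.mem_iInter.2 fun l => ?_⟩
    by_cases hl : u ∈ H l
    · refine Or.inr ?_
      rcases eq_or_ne l k with rfl | hlk
      · exact le_refl (inner ℝ (T.discCenter l - z) (outVelocity x u))
      · exact (h.inner_center_lt (outVelocity_ne_zero hx u) hlk hl.1 hl.2).le
    · exact Or.inl hl
  have heq : ∀ k, ∀ u ∈ E k, T.nextState x.1 (outVelocity x u) = T.hitState z (outVelocity x u) k := by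
    intro k u hu
    obtain ⟨t, j, h, hj, -⟩ := T.firstHit_outVelocity hT hx u
    have hjk : j = k := by
      by_contra hne
      have h1 := h.inner_center_lt (outVelocity_ne_zero hx u) (Ne.symm hne) hu.1.1 hu.1.2
      rcases Set.mem_iInter.1 hu.2 j with h2 | h2
      · exact h2 (hmemH h)
      · exact absurd h1 (not_lt.2 h2)
    subst hjk
    exact T.nextState_eq_hitState (outVelocity_ne_zero hx u) h hj
  intro S hS
  have : (fun u => T.nextState x.1 (outVelocity x u)) ⁻¹' S =
      ⋃ k, E k ∩ (fun u => T.hitState z (outVelocity x u) k) ⁻¹' S := by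
    ext u
    simp only [Set.mem_preimage, Set.mem_iUnion, Set.mem_inter_iff]
    constructor
    · intro h
      obtain ⟨k, hk⟩ := hcover u
      exact ⟨k, hk, heq k u hk ▸ h⟩
    · rintro ⟨k, hk, h⟩
      rw [heq k u hk]; exact h
  rw [this]
  exact MeasurableSet.iUnion fun k => (hE k).inter
    (((T.measurable_hitState z k).comp hcont.measurable) hS)

theorem measurable_potential (ε vmin vmax A : ℝ) :
    Measurable (potential ε vmin vmax A : PhaseSpace p → ENNReal) := by
  have h2 : Measurable fun x : PhaseSpace p => (x.2 : ℝ) := by fun_prop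
  unfold potential
  refine Measurable.ite (measurableSet_lt h2 measurable_const) (by fun_prop)
    (Measurable.ite (measurableSet_le h2 measurable_const) measurable_const (by fun_prop))

/-! ### The transition as an integral over tangential velocity or angle -/

/-- The density of the tangential velocity. -/
noncomputable def gaussDensity (β u : ℝ) : ENNReal :=
  ENNReal.ofReal (Real.sqrt (β / Real.pi) * Real.exp (-β * u ^ 2))

theorem measurable_gaussDensity (β : ℝ) : Measurable (gaussDensity β) := by
  unfold gaussDensity; fun_prop

theorem pullback_eq_lintegral (hT : T.BoundedHorizon) {x : PhaseSpace p} (hx : 0 < x.2)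
    {f : PhaseSpace p → ENNReal} (hf : Measurable f) :
    T.pullback f x = ∫⁻ u, gaussDensity (T.beta x.1.1) u *
      f (T.nextState x.1 (outVelocity x u)) := by
  rw [pullback, transition, lintegral_map hf (T.measurable_nextState hT hx), tangentialLaw]
  exact lintegral_withDensity_eq_lintegral_mul _ (measurable_gaussDensity _)
    (hf.comp (T.measurable_nextState hT hx))

theorem lintegral_eq_lintegral_tan {v : ℝ} (hv : 0 < v) (F : ℝ → ENNReal) :
    ∫⁻ u, F u = ∫⁻ φ in Set.Ioo (-(Real.pi / 2)) (Real.pi / 2),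
      ENNReal.ofReal (v / Real.cos φ ^ 2) * F (v * Real.tan φ) := by
  have himage : (fun φ => v * Real.tan φ) '' Set.Ioo (-(Real.pi / 2)) (Real.pi / 2) = Set.univ := by
    rw [← Set.image_image (fun t => v * t) Real.tan, Real.image_tan_Ioo]
    exact Set.image_univ_of_surjective (mul_left_surjective₀ hv.ne')
  have hinj : Set.InjOn (fun φ => v * Real.tan φ) (Set.Ioo (-(Real.pi / 2)) (Real.pi / 2)) :=
    fun a ha b hb h => Real.injOn_tan ha hb (mul_left_cancel₀ hv.ne' h)
  have := lintegral_image_eq_lintegral_abs_deriv_mul (f' := fun φ => v * (1 / Real.cos φ ^ 2))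
    measurableSet_Ioo (fun φ hφ => ((Real.hasDerivAt_tan_of_mem_Ioo hφ).const_mul v).hasDerivWithinAt)
    hinj F
  rw [himage, Measure.restrict_univ] at this
  rw [this]
  refine lintegral_congr fun φ => ?_
  rw [mul_one_div, abs_of_nonneg (by positivity)]

/-- The substitution `u = v tan φ`; its Jacobian `v / cos² φ` turns the Gaussian into
`angleDensity`. -/
theorem pullback_eq_lintegral_angle (hT : T.BoundedHorizon) {x : PhaseSpace p} (hx : 0 < x.2)
    {f : PhaseSpace p → ENNReal} (hf : Measurable f) :
    T.pullback f x = ∫⁻ φ in Set.Ioo (-(Real.pi / 2)) (Real.pi / 2),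
      f (T.nextState x.1 (outVelocityAngle x φ)) *
        ENNReal.ofReal (angleDensity (T.beta x.1.1) (x.2 : ℝ) φ) := by
  have hv : (0 : ℝ) < x.2 := hx
  rw [T.pullback_eq_lintegral hT hx hf, lintegral_eq_lintegral_tan hv]
  refine setLIntegral_congr_fun measurableSet_Ioo fun φ hφ => ?_
  have hcos := Real.cos_pos_of_mem_Ioo hφ
  rw [outVelocityAngle_eq x hcos.ne', ← mul_assoc, mul_comm, gaussDensity,
    ← ENNReal.ofReal_mul (by positivity)]
  congr 2
  rw [angleDensity, mul_pow]
  ring_nf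

/-! ### Loss of normal speed through dispersing collisions -/

theorem abs_cross_le_of_norm_sub_le {X w w' : ℂ} {g v M : ℝ} (hX : ‖X‖ ≤ M)
    (hw' : ‖w - w'‖ * M ≤ g / 2 * v) (hc : |cross X w| ≤ g / 2 * v) : |cross X w'| ≤ g * v := by
  have e : cross X w' = cross X w - cross X (w - w') := by
    simp only [cross, inner_sub_right]; ring
  have h1 := abs_cross_le X (w - w')
  have h2 : ‖X‖ * ‖w - w'‖ ≤ ‖w - w'‖ * M := by
    rw [mul_comm]; gcongr
  have h3 := abs_sub (cross X w) (cross X (w - w'))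
  rw [e]; linarith

/-- A nearly central aim gives `inner ℝ X w ≥ g * v`, whereas the change of velocity costs at most
`g / 2 * v`. With the preceding lemma, a disc hit nearly centrally remains on the ray after a small
change of velocity. -/
theorem inner_pos_of_norm_sub_le {X w w' : ℂ} {g v M : ℝ} (hg : 0 < g) (hv : 0 < v)
    (hX : ‖X‖ ≤ M) (hX' : 2 * g ≤ ‖X‖) (hw : v ≤ ‖w‖)
    (hw' : ‖w - w'‖ * M ≤ g / 2 * v) (hc : |cross X w| ≤ g / 2 * v) (hi : 0 < inner ℝ X w) :
    0 < inner ℝ X w' := by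
  have e : inner ℝ X w' = inner ℝ X w - inner ℝ X (w - w') := by
    simp only [inner_sub_right]; ring
  have h1 := (le_abs_self _).trans (abs_real_inner_le_norm X (w - w'))
  have h2 : ‖X‖ * ‖w - w'‖ ≤ ‖w - w'‖ * M := by
    rw [mul_comm]; gcongr
  have h3 := inner_sq_add_cross_sq X w
  have h4 : (2 * g) ^ 2 * v ^ 2 ≤ ‖X‖ ^ 2 * ‖w‖ ^ 2 := by gcongr
  have h5 : cross X w ^ 2 ≤ (g / 2 * v) ^ 2 := sq_le_sq' (by linarith [abs_le.1 hc])
    (abs_le.1 hc).2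
  have h6 : g * v ≤ inner ℝ X w := by
    refine le_of_sq_le_sq ?_ hi.le
    have : 0 < (g * v) ^ 2 := by positivity
    nlinarith
  have : 0 < g * v := by positivity
  linarith

/-- A common set of constants describing the geometry of the table: `g` is half a lower bound for
the gaps and a quarter of a lower bound for the diameters, `M` bounds the radii and the free
flights. -/
structure GeometryBounds (g M : ℝ) : Prop where
  pos : 0 < g
  two_mul_le_radius : ∀ i, 2 * g ≤ T.radius i
  radius_le : ∀ i, T.radius i ≤ M
  gap : ∀ k l, k ≠ l → T.radius k.1 + T.radius l.1 + g ≤ ‖T.discCenter k - T.discCenter l‖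
  flight : ∀ (z w : ℂ) (t : ℝ) (k : Fin p × ℤ × ℤ) (n : ℂ), w ≠ 0 → T.FirstHit z w t k n →
      ‖T.discCenter k - z‖ ≤ M
  bound_pos : 0 < M

theorem exists_geometryBounds (hT : T.BoundedHorizon) : ∃ g M : ℝ, T.GeometryBounds g M := by
  obtain ⟨g, hg, hgap⟩ := T.exists_gap
  obtain ⟨a, B, ha, -, hB⟩ := T.exists_radius_bounds
  obtain ⟨L, hL0, hL⟩ := T.exists_flight_bound hT
  refine ⟨min g (a / 2), max L B, ⟨by positivity, fun i => ?_, fun i => ?_, fun k l h => ?_,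
    fun z w t k n hw h => ?_, lt_max_of_lt_left hL0⟩⟩
  · linarith [min_le_right g (a / 2), (hB i).1]
  · exact (hB i).2.trans (le_max_right _ _)
  · linarith [min_le_left g (a / 2), hgap k l h]
  · exact (hL z w t k n hw h).trans (le_max_left _ _)

/-- At most one disc is hit almost centrally by the particles leaving a point almost normally. -/
theorem GeometryBounds.eq_of_central {T : ThermostatTable p} {g M : ℝ} (hG : T.GeometryBounds g M)
    {x : PhaseSpace p} (hx : 0 < x.2) {u₁ u₂ : ℝ} {t₁ t₂ : ℝ} {k₁ k₂ : Fin p × ℤ × ℤ} {n₁ n₂ : ℂ}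
    (h₁ : T.FirstHit (T.lift x.1) (outVelocity x u₁) t₁ k₁ n₁)
    (h₂ : T.FirstHit (T.lift x.1) (outVelocity x u₂) t₂ k₂ n₂)
    (hk₁ : k₁ ≠ (x.1.1, 0)) (hk₂ : k₂ ≠ (x.1.1, 0))
    (hu₁ : |u₁| ≤ g / (4 * M) * x.2) (hu₂ : |u₂| ≤ g / (4 * M) * x.2)
    (hc₁ : |cross (T.discCenter k₁ - T.lift x.1) (outVelocity x u₁)| ≤ g / 2 * x.2)
    (hc₂ : |cross (T.discCenter k₂ - T.lift x.1) (outVelocity x u₂)| ≤ g / 2 * x.2) :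
    k₁ = k₂ := by
  by_contra hne
  have hg := hG.pos
  have hM := hG.bound_pos
  have hw₁ := outVelocity_ne_zero hx u₁
  have hw₂ := outVelocity_ne_zero hx u₂
  have hv : (0 : ℝ) < x.2 := hx
  have hnw : ∀ u, (x.2 : ℝ) ≤ ‖outVelocity x u‖ := fun u => by
    refine le_of_sq_le_sq ?_ (norm_nonneg _)
    rw [norm_outVelocity_sq]; nlinarith [sq_nonneg u]
  have hd : ‖outVelocity x u₁ - outVelocity x u₂‖ * M ≤ g / 2 * x.2 := by
    rw [outVelocity_sub]
    have h1 : |u₁ - u₂| ≤ g / (4 * M) * x.2 + g / (4 * M) * x.2 :=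
      (abs_sub _ _).trans (add_le_add hu₁ hu₂)
    have h2 : |u₁ - u₂| * M ≤ (g / (4 * M) * x.2 + g / (4 * M) * x.2) * M := by gcongr
    have h3 : (g / (4 * M) * x.2 + g / (4 * M) * x.2) * M = g / 2 * x.2 := by field_simp; ring
    linarith
  have hd' : ‖outVelocity x u₂ - outVelocity x u₁‖ * M ≤ g / 2 * x.2 := by rwa [norm_sub_rev]
  have hX₁ := hG.flight _ _ _ _ _ hw₁ h₁
  have hX₂ := hG.flight _ _ _ _ _ hw₂ h₂
  have hX : ∀ k, k ≠ (x.1.1, 0) → 2 * g ≤ ‖T.discCenter k - T.lift x.1‖ := fun k hk => by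
    linarith [T.radius_add_le_norm_sub_lift hG.gap x.1 hk, hG.two_mul_le_radius k.1]
  have hgR : ∀ i u, g * x.2 ≤ T.radius i * ‖outVelocity x u‖ := fun i u =>
    mul_le_mul (by linarith [hG.two_mul_le_radius i]) (hnw u) hv.le (T.radius_pos i).le
  have c12 := abs_cross_le_of_norm_sub_le hX₁ hd hc₁
  have c21 := abs_cross_le_of_norm_sub_le hX₂ hd' hc₂
  have i12 := inner_pos_of_norm_sub_le hg hv hX₁ (hX k₁ hk₁) (hnw _) hd hc₁
    (h₁.inner_center_pos hw₁)
  have i21 := inner_pos_of_norm_sub_le hg hv hX₂ (hX k₂ hk₂) (hnw _) hd' hc₂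
    (h₂.inner_center_pos hw₂)
  -- Each ray meets both discs, and each hits its own disc first: the two rays see the centres in
  -- opposite orders.
  have l2 := h₂.inner_center_lt hw₂ hne (c12.trans (hgR _ _)) i12
  have l1 := h₁.inner_center_lt hw₁ (Ne.symm hne) (c21.trans (hgR _ _)) i21
  set X₁ := T.discCenter k₁ - T.lift x.1 with hX₁def
  set X₂ := T.discCenter k₂ - T.lift x.1 with hX₂def
  set w₁ := outVelocity x u₁
  set w₂ := outVelocity x u₂
  have hΔ : 4 * g ≤ ‖X₂ - X₁‖ := by
    have e : X₂ - X₁ = T.discCenter k₂ - T.discCenter k₁ := by rw [hX₁def, hX₂def]; ring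
    rw [e]
    linarith [hG.gap k₂ k₁ (Ne.symm hne), hG.two_mul_le_radius k₁.1, hG.two_mul_le_radius k₂.1]
  have hΔ' : ‖X₂ - X₁‖ ≤ 2 * M := by linarith [norm_sub_le X₂ X₁]
  have hcΔ : |cross (X₂ - X₁) w₁| ≤ 3 / 2 * g * x.2 := by
    have e : cross (X₂ - X₁) w₁ = cross X₂ w₁ - cross X₁ w₁ := by
      simp only [cross, mul_sub, inner_sub_left]
    rw [e]
    linarith [abs_sub (cross X₂ w₁) (cross X₁ w₁)]
  -- The centres are `4g` apart and 16 - 9/4 ≥ 9. Passing from `w₁` to `w₂` changes this inner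
  -- product by at most `g * x.2`, too little for the reversal of sign in `l2`.
  have hi : 3 * g * x.2 ≤ inner ℝ (X₂ - X₁) w₁ := by
    refine le_of_sq_le_sq ?_ (by rw [inner_sub_left]; linarith)
    have h3 := inner_sq_add_cross_sq (X₂ - X₁) w₁
    have h4 : (4 * g) ^ 2 * (x.2 : ℝ) ^ 2 ≤ ‖X₂ - X₁‖ ^ 2 * ‖w₁‖ ^ 2 := by
      gcongr; exact hnw _
    have h5 : cross (X₂ - X₁) w₁ ^ 2 ≤ (3 / 2 * g * x.2) ^ 2 :=
      sq_le_sq' (by linarith [abs_le.1 hcΔ]) (abs_le.1 hcΔ).2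
    have : 0 < (g * (x.2 : ℝ)) ^ 2 := by positivity
    nlinarith
  have h6 := (le_abs_self _).trans (abs_real_inner_le_norm (X₂ - X₁) (w₁ - w₂))
  have h7 : ‖X₂ - X₁‖ * ‖w₁ - w₂‖ ≤ 2 * M * ‖w₁ - w₂‖ := by gcongr
  have h8 : inner ℝ (X₂ - X₁) (w₁ - w₂) =
      inner ℝ (X₂ - X₁) w₁ + (inner ℝ X₁ w₂ - inner ℝ X₂ w₂) := by
    simp only [inner_sub_left, inner_sub_right]; ring
  have : 0 < g * x.2 := by positivity
  linarith

theorem nextState_snd_sq {r : BoundaryPoint p} {w : ℂ} {t : ℝ} {k : Fin p × ℤ × ℤ}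
    (h : T.FirstHit (T.lift r) w t k (T.nextState r w).1.2) :
    ((T.nextState r w).2 : ℝ) ^ 2 =
      ‖w‖ ^ 2 - (cross (T.discCenter k - T.lift r) w / T.radius k.1) ^ 2 := by
  rw [nextState_snd, sq_abs, h.inner_normal_sq]

/-- The loss of normal speed: unless the tangential velocity `u` is large, or a fixed proportion of
the energy becomes tangential, the tangential velocity at the collision is an expanding affine
function of `u`. -/
theorem exists_normal_speed_bound (hT : T.BoundedHorizon) : ∃ κ τ c : ℝ, 1 < κ ∧ 0 < τ ∧ 0 < c ∧
    ∀ x : PhaseSpace p, 0 < x.2 → ∃ s : ℝ, ∀ u : ℝ, τ * x.2 < |u| ∨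
      ((T.nextState x.1 (outVelocity x u)).2 : ℝ) ^ 2 ≤ x.2 ^ 2 + u ^ 2 - c * x.2 ^ 2 ∨
      ((T.nextState x.1 (outVelocity x u)).2 : ℝ) ^ 2 ≤ x.2 ^ 2 + u ^ 2 - κ * (u - s) ^ 2 := by
  obtain ⟨g, M, hG⟩ := T.exists_geometryBounds hT
  have hg := hG.pos
  have hM := hG.bound_pos
  refine ⟨1 + g / M, g / (4 * M), (g / (2 * M)) ^ 2, by have := div_pos hg hM; linarith,
    by positivity, by positivity, fun x hx => ?_⟩
  have hv : (0 : ℝ) < x.2 := hx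
  set z := T.lift x.1 with hz
  -- The remaining case: a nearly normal particle hits disc `k` nearly centrally.
  let P : (Fin p × ℤ × ℤ) → ℝ → Prop := fun k u =>
    k ≠ (x.1.1, 0) ∧ |u| ≤ g / (4 * M) * x.2 ∧
      |cross (T.discCenter k - z) (outVelocity x u)| ≤ g / 2 * x.2 ∧
      ∃ t, T.FirstHit z (outVelocity x u) t k (T.nextState x.1 (outVelocity x u)).1.2
  have hdich : ∀ u, g / (4 * M) * x.2 < |u| ∨
      ((T.nextState x.1 (outVelocity x u)).2 : ℝ) ^ 2 ≤
        x.2 ^ 2 + u ^ 2 - (g / (2 * M)) ^ 2 * x.2 ^ 2 ∨ ∃ k, P k u := by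
    intro u
    by_contra! hcon
    obtain ⟨h1, h2, h3⟩ := hcon
    obtain ⟨t, k, h, -, hk⟩ := T.firstHit_outVelocity hT hx u
    refine h3 k ⟨hk, h1, ?_, t, h⟩
    have hR := T.radius_pos k.1
    rw [T.nextState_snd_sq h, norm_outVelocity_sq] at h2
    have h4 : (cross (T.discCenter k - z) (outVelocity x u) / T.radius k.1) ^ 2 ≤
        (g / (2 * M) * x.2) ^ 2 := by rw [mul_pow]; linarith
    have h5 := abs_le_of_sq_le_sq h4 (by positivity)
    rw [abs_div, abs_of_pos hR, div_le_iff₀ hR] at h5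
    refine h5.trans ?_
    have h6 : g / (2 * M) * x.2 * T.radius k.1 ≤ g / (2 * M) * x.2 * M := by
      gcongr; exact hG.radius_le _
    have h7 : g / (2 * M) * x.2 * M = g / 2 * x.2 := by field_simp
    linarith
  by_cases hex : ∃ k u, P k u
  · obtain ⟨k, u₀, hk, hu₀, hc₀, t₀, h₀⟩ := hex
    set a := cross (T.discCenter k - z) x.1.2
    set b := inner ℝ (T.discCenter k - z) (x.1.2 : ℂ)
    have hR := T.radius_pos k.1
    have hX := hG.flight _ _ _ _ _ (outVelocity_ne_zero hx u₀) h₀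
    have hX' := T.radius_add_le_norm_sub_lift hG.gap x.1 hk
    have hab : b ^ 2 + a ^ 2 = ‖T.discCenter k - z‖ ^ 2 := by
      have := inner_sq_add_cross_sq (T.discCenter k - z) x.1.2
      rwa [Circle.norm_coe, one_pow, mul_one] at this
    have hbM : |b| ≤ M := by
      have := abs_real_inner_le_norm (T.discCenter k - z) (x.1.2 : ℂ)
      rw [Circle.norm_coe, mul_one] at this
      exact this.trans hX
    have haux : |a| ≤ g := by
      have e : x.2 * a = cross (T.discCenter k - z) (outVelocity x u₀) - u₀ * b := by
        rw [cross_outVelocity]; ring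
      have h1 := abs_sub (cross (T.discCenter k - z) (outVelocity x u₀)) (u₀ * b)
      have h2 : |u₀ * b| ≤ g / (4 * M) * x.2 * M := by
        rw [abs_mul]; gcongr
      have h3 : g / (4 * M) * x.2 * M = g / 4 * x.2 := by field_simp
      have h4 : |x.2 * a| ≤ x.2 * g := by
        rw [e]; nlinarith
      rw [abs_mul, abs_of_pos hv] at h4
      exact le_of_mul_le_mul_left h4 hv
    -- From `(R + g)² - g²`. The squared slope `b² / R²` is thus at least `1 + 2g/R`, which exceeds
    -- `κ = 1 + g/M`.
    have hb2 : T.radius k.1 ^ 2 + 2 * T.radius k.1 * g ≤ b ^ 2 := by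
      have h1 : (T.radius k.1 + g) ^ 2 ≤ ‖T.discCenter k - z‖ ^ 2 := by gcongr
      have h2 : a ^ 2 ≤ g ^ 2 := sq_le_sq' (by linarith [abs_le.1 haux]) (abs_le.1 haux).2
      nlinarith
    have hb0 : b ≠ 0 := by
      rintro h
      rw [h] at hb2
      have : 0 < T.radius k.1 ^ 2 + 2 * T.radius k.1 * g := by positivity
      norm_num at hb2
      linarith
    -- The zero of the affine function `u ↦ x.2 * a + u * b`, the oriented area for disc `k`.
    refine ⟨-(x.2 * a / b), fun u => ?_⟩
    rcases hdich u with h | h | ⟨k', hk', hu', hc', t', h'⟩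
    · exact Or.inl h
    · exact Or.inr (Or.inl h)
    · refine Or.inr (Or.inr ?_)
      obtain rfl : k' = k := hG.eq_of_central hx h' h₀ hk' hk hu' hu₀ hc' hc₀
      rw [T.nextState_snd_sq h', norm_outVelocity_sq]
      have e : cross (T.discCenter k' - z) (outVelocity x u) = b * (u - -(x.2 * a / b)) := by
        rw [cross_outVelocity]; field_simp; ring
      rw [← hz, e, div_pow, mul_pow]
      refine sub_le_sub_left ?_ _
      rw [le_div_iff₀ (by positivity), mul_right_comm]
      refine mul_le_mul_of_nonneg_right (le_trans ?_ hb2) (sq_nonneg _)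
      have h1 : g / M * T.radius k'.1 ≤ g := by
        rw [div_mul_eq_mul_div, div_le_iff₀ hM]
        exact mul_le_mul_of_nonneg_left (hG.radius_le _) hg.le
      nlinarith [mul_le_mul_of_nonneg_right h1 hR.le, mul_pos hg hR]
  · refine ⟨0, fun u => ?_⟩
    rcases hdich u with h | h | ⟨k, hk⟩
    · exact Or.inl h
    · exact Or.inr (Or.inl h)
    · exact absurd ⟨k, u, hk⟩ hex

/-! ### Gaussian integrals and the drift of exp(ε v⊥²) -/

theorem lintegral_exp_neg_mul_sub_sq {b : ℝ} (hb : 0 < b) (m : ℝ) :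
    ∫⁻ u : ℝ, ENNReal.ofReal (Real.exp (-b * (u - m) ^ 2)) =
      ENNReal.ofReal √(Real.pi / b) := by
  rw [lintegral_sub_right_eq_self (fun u : ℝ => ENNReal.ofReal (Real.exp (-b * u ^ 2))) m,
    ← ofReal_integral_eq_lintegral_ofReal (integrable_exp_neg_mul_sq hb)
      (Filter.Eventually.of_forall fun u => (Real.exp_pos _).le), integral_gaussian]

theorem lintegral_gaussDensity_mul_exp {β b : ℝ} (hβ : 0 < β) (hb : 0 < b) (a m : ℝ) :
    ∫⁻ u : ℝ, ENNReal.ofReal (√(β / Real.pi) * (Real.exp a * Real.exp (-b * (u - m) ^ 2))) =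
      ENNReal.ofReal (Real.exp a * √(β / b)) := by
  have h1 : ∀ u : ℝ, ENNReal.ofReal (√(β / Real.pi) * (Real.exp a * Real.exp (-b * (u - m) ^ 2))) =
      ENNReal.ofReal (√(β / Real.pi) * Real.exp a) *
        ENNReal.ofReal (Real.exp (-b * (u - m) ^ 2)) := fun u => by
    rw [← ENNReal.ofReal_mul (by positivity), mul_assoc]
  simp_rw [h1]
  rw [lintegral_const_mul _ (by fun_prop), lintegral_exp_neg_mul_sub_sq hb,
    ← ENNReal.ofReal_mul (by positivity), mul_comm (√(β / Real.pi)), mul_assoc,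
    ← Real.sqrt_mul (by positivity)]
  congr 3
  have := Real.pi_pos
  field_simp

/-- Beyond the threshold `2C/(θ(1 - γ))` the decaying term is at most `(1 - γ)/2`, by `exp t ≥ t`;
below it that term is bounded by the constant. -/
theorem exp_mul_add_le {ε θ C γ : ℝ} (hε : 0 < ε) (hθ : 0 < θ) (hC : 0 < C) (hγ : γ < 1)
    {y : ℝ} (hy : 0 ≤ y) :
    Real.exp (ε * y) * (C * Real.exp (-θ * y) + γ) ≤
      (1 + γ) / 2 * Real.exp (ε * y) + C * Real.exp (ε * (2 * C / (θ * (1 - γ)))) := by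
  have h1 : 0 < 1 - γ := by linarith
  rcases le_or_gt (2 * C / (θ * (1 - γ))) y with h | h
  · have h2 : C * Real.exp (-θ * y) ≤ (1 - γ) / 2 := by
      have h3 : θ * y ≤ Real.exp (θ * y) := by linarith [Real.add_one_le_exp (θ * y)]
      rw [neg_mul, Real.exp_neg, ← div_eq_mul_inv, div_le_iff₀ (Real.exp_pos _)]
      rw [div_le_iff₀ (by positivity)] at h
      nlinarith
    have h4 : 0 < C * Real.exp (ε * (2 * C / (θ * (1 - γ)))) := by positivity
    nlinarith [Real.exp_pos (ε * y)]
  · have h2 : Real.exp (ε * y) ≤ Real.exp (ε * (2 * C / (θ * (1 - γ)))) := by gcongr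
    have h3 : Real.exp (-θ * y) ≤ 1 := Real.exp_le_one_iff.2 (by nlinarith)
    have h4 : Real.exp (ε * y) * (C * Real.exp (-θ * y)) ≤
        Real.exp (ε * (2 * C / (θ * (1 - γ)))) * (C * 1) := by gcongr
    nlinarith [Real.exp_pos (ε * y)]

/-- The drift condition for the potential `exp (ε v⊥²)`. -/
theorem exists_lintegral_exp_le (hT : T.BoundedHorizon) {ε ε' : ℝ} (hε : 0 < ε) (hε' : ε < ε')
    (hβ : ∀ i, ε' < T.beta i) : ∃ γ K : ℝ, 0 < γ ∧ γ < 1 ∧ 0 < K ∧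
    ∀ x : PhaseSpace p, 0 < x.2 → ∫⁻ u, gaussDensity (T.beta x.1.1) u *
      ENNReal.ofReal (Real.exp (ε * ((T.nextState x.1 (outVelocity x u)).2 : ℝ) ^ 2)) ≤
        ENNReal.ofReal (γ * Real.exp (ε * x.2 ^ 2) + K) := by
  obtain ⟨κ, τ, c, hκ, hτ, hc, hbound⟩ := T.exists_normal_speed_bound hT
  have hC : ∀ᶠ C in Filter.atTop, ∀ i, √(T.beta i / (T.beta i - ε')) ≤ C :=
    Filter.eventually_all.2 fun i => Filter.eventually_ge_atTop _
  obtain ⟨C, hC, hC0⟩ := (hC.and (Filter.eventually_gt_atTop 0)).exists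
  have hγ : ∀ᶠ γ in nhdsWithin (1 : ℝ) (Set.Iio 1),
      ∀ i, √(T.beta i / (T.beta i + ε * (κ - 1))) ≤ γ := by
    refine Filter.eventually_all.2 fun i => ?_
    have h1 : √(T.beta i / (T.beta i + ε * (κ - 1))) < 1 := by
      have h2 : 0 < ε * (κ - 1) := mul_pos hε (by linarith)
      rw [Real.sqrt_lt' one_pos, one_pow, div_lt_one (by linarith [T.beta_pos i])]
      linarith
    exact Filter.eventually_of_mem (Ico_mem_nhdsLT h1) fun γ h => h.1
  obtain ⟨γ, hγ, hγ0, hγ1⟩ := (hγ.and (Ioo_mem_nhdsLT zero_lt_one)).exists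
  -- The exponential gain in the two easy cases: for `|u| > τ v` the slack between `ε` and `ε'` pays
  -- for it, otherwise the lost share `c` of the energy does.
  set θ := min ((ε' - ε) * τ ^ 2) (ε * c) with hθ
  have hθ0 : 0 < θ := lt_min (mul_pos (by linarith) (by positivity)) (by positivity)
  refine ⟨(1 + γ) / 2, C * Real.exp (ε * (2 * C / (θ * (1 - γ)))), by linarith, by linarith,
    by positivity, fun x hx => ?_⟩
  obtain ⟨s, hs⟩ := hbound x hx
  set β := T.beta x.1.1 with hβdef
  have hβ0 : 0 < β := T.beta_pos _
  have hβε := hβ x.1.1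
  rw [← hβdef] at hβε
  set v : ℝ := ((x.2 : NNReal) : ℝ) with hv
  set b := β + ε * (κ - 1) with hb
  have hb0 : 0 < b := by have : 0 < ε * (κ - 1) := mul_pos hε (by linarith)
                         linarith
  set m := ε * κ * s / b with hm
  have hpt : ∀ u, gaussDensity β u *
      ENNReal.ofReal (Real.exp (ε * ((T.nextState x.1 (outVelocity x u)).2 : ℝ) ^ 2)) ≤
      ENNReal.ofReal (√(β / Real.pi) * (Real.exp (ε * v ^ 2 - θ * v ^ 2) *
        Real.exp (-(β - ε') * (u - 0) ^ 2))) +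
      ENNReal.ofReal (√(β / Real.pi) * (Real.exp (ε * v ^ 2) *
        Real.exp (-b * (u - m) ^ 2))) := by
    intro u
    rw [gaussDensity, ← ENNReal.ofReal_mul (by positivity), mul_assoc, ← Real.exp_add,
      ← Real.exp_add, ← Real.exp_add]
    have hθv : θ * v ^ 2 ≤ (ε' - ε) * (τ * v) ^ 2 := by
      have : θ ≤ (ε' - ε) * τ ^ 2 := min_le_left _ _
      nlinarith [sq_nonneg v]
    have hθv' : θ * v ^ 2 ≤ ε * (c * v ^ 2) := by
      have : θ ≤ ε * c := min_le_right _ _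
      nlinarith [sq_nonneg v]
    have hv0 : 0 ≤ v := x.2.2
    obtain ⟨t, k, h, -, -⟩ := T.firstHit_outVelocity hT hx u
    have hen : ((T.nextState x.1 (outVelocity x u)).2 : ℝ) ^ 2 ≤ v ^ 2 + u ^ 2 := by
      rw [T.nextState_snd_sq h, norm_outVelocity_sq]
      linarith [sq_nonneg (cross (T.discCenter k - T.lift x.1) (outVelocity x u) / T.radius k.1)]
    have hu2 : ε * u ^ 2 ≤ ε' * u ^ 2 := by gcongr
    rcases hs u with h1 | h1 | h1
    · refine le_add_right (ENNReal.ofReal_le_ofReal (mul_le_mul_of_nonneg_left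
        (Real.exp_le_exp.2 ?_) (by positivity)))
      have h2 : (τ * v) ^ 2 ≤ u ^ 2 := by
        rw [← sq_abs u]; gcongr
      have h3 := mul_le_mul_of_nonneg_left hen hε.le
      have h4 := mul_le_mul_of_nonneg_left h2 (sub_pos.2 hε').le
      nlinarith
    · refine le_add_right (ENNReal.ofReal_le_ofReal (mul_le_mul_of_nonneg_left
        (Real.exp_le_exp.2 ?_) (by positivity)))
      have h3 := mul_le_mul_of_nonneg_left h1 hε.le
      nlinarith
    · refine le_add_left (ENNReal.ofReal_le_ofReal (mul_le_mul_of_nonneg_left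
        (Real.exp_le_exp.2 ?_) (by positivity)))
      have h3 := mul_le_mul_of_nonneg_left h1 hε.le
      have h4 : 0 ≤ ε * κ * s ^ 2 * (β - ε) / b := by
        have : 0 < β - ε := by linarith
        positivity
      -- Completing the square; the remainder has a favourable sign, so the bound does not depend on
      -- `s`.
      have h5 : -β * u ^ 2 + ε * (v ^ 2 + u ^ 2 - κ * (u - s) ^ 2) =
          ε * v ^ 2 + -b * (u - m) ^ 2 - ε * κ * s ^ 2 * (β - ε) / b := by
        rw [hm]; field_simp; rw [hb]; ring
      linarith
  refine (lintegral_mono hpt).trans ?_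
  rw [lintegral_add_left (by fun_prop), lintegral_gaussDensity_mul_exp hβ0 (by linarith),
    lintegral_gaussDensity_mul_exp hβ0 hb0, ← ENNReal.ofReal_add (by positivity) (by positivity)]
  refine ENNReal.ofReal_le_ofReal (le_trans ?_
    (exp_mul_add_le hε hθ0 hC0 hγ1 (y := v ^ 2) (by positivity)))
  rw [sub_eq_add_neg, Real.exp_add, mul_add, mul_assoc, ← neg_mul, mul_comm C]
  gcongr
  · exact hC _
  · exact hγ _

/-! ### Grazing singularities and the drift of 1/v⊥ -/

/-- The power `A⁻ˢ` with values in `[0, ∞]`, infinite for `A = 0`. -/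
noncomputable def invPow (s A : ℝ) : ENNReal := (ENNReal.ofReal (A ^ s))⁻¹

theorem invPow_anti {s A B : ℝ} (hs : 0 ≤ s) (hA : 0 ≤ A) (h : A ≤ B) :
    invPow s B ≤ invPow s A := by
  unfold invPow
  gcongr

/-- Replacing the larger of `A` and `B` by the smaller only increases the product. -/
theorem invPow_mul_invPow_le {s s' A B : ℝ} (hs : 0 < s) (hs' : 0 < s') (hA : 0 ≤ A)
    (hB : 0 ≤ B) : invPow s A * invPow s' B ≤ invPow (s + s') A + invPow (s + s') B := by
  have key : ∀ C, 0 ≤ C → invPow s C * invPow s' C = invPow (s + s') C := by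
    intro C hC
    unfold invPow
    rw [← ENNReal.mul_inv (Or.inr ENNReal.ofReal_ne_top) (Or.inl ENNReal.ofReal_ne_top),
      ← ENNReal.ofReal_mul (by positivity), Real.rpow_add_of_nonneg hC hs.le hs'.le]
  rcases le_total A B with h | h
  · refine le_add_right ?_
    rw [← key A hA]
    exact mul_le_mul_right (invPow_anti hs'.le hA h) _
  · refine le_add_left ?_
    rw [← key B hB]
    exact mul_le_mul_left (invPow_anti hs.le hB h) _

theorem lintegral_invPow_abs_lt_top :
    ∫⁻ y in Set.Ioc (-2 : ℝ) 2, invPow (3 / 4) (|y| / 2) < ⊤ := by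
  set H : ℝ → ENNReal := (Set.Ioc (0 : ℝ) 2).indicator
    fun y => ENNReal.ofReal ((1 / 2 : ℝ) ^ (-(3 / 4) : ℝ) * y ^ (-(3 / 4) : ℝ)) with hH
  have hHfin : ∫⁻ y, H y < ⊤ := by
    rw [hH, lintegral_indicator measurableSet_Ioc]
    have hi := (intervalIntegral.intervalIntegrable_rpow' (a := 0) (b := 2)
      (r := -(3 / 4)) (by norm_num)).const_mul ((1 / 2 : ℝ) ^ (-(3 / 4) : ℝ))
    rw [intervalIntegrable_iff_integrableOn_Ioc_of_le (by norm_num)] at hi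
    exact hi.lintegral_lt_top
  have hHm : Measurable H := by
    rw [hH]; exact Measurable.indicator (by fun_prop) measurableSet_Ioc
  rw [← lintegral_indicator measurableSet_Ioc]
  have hle : ∫⁻ y, (Set.Ioc (-2 : ℝ) 2).indicator (fun y => invPow (3 / 4) (|y| / 2)) y ≤
      ∫⁻ y, (H y + H (-y)) := by
    refine lintegral_mono_ae ?_
    have h2 : ∀ᵐ y : ℝ, y ≠ 0 ∧ y ≠ -2 := by
      simp only [ae_iff, not_and_or, not_not]
      exact (Set.Finite.subset (Set.toFinite {0, -2}) fun y hy => by simpa using hy).measure_zero _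
    filter_upwards [h2] with y hy
    by_cases hmem : y ∈ Set.Ioc (-2 : ℝ) 2
    · rw [Set.indicator_of_mem hmem]
      have key : invPow (3 / 4) (|y| / 2) =
          ENNReal.ofReal ((1 / 2 : ℝ) ^ (-(3 / 4) : ℝ) * |y| ^ (-(3 / 4) : ℝ)) := by
        have hpos : 0 < |y| := abs_pos.2 hy.1
        rw [invPow, ← ENNReal.ofReal_inv_of_pos (by positivity),
          ← Real.mul_rpow (by norm_num) hpos.le, Real.rpow_neg (by positivity)]
        congr 3; ring
      rw [key]
      rcases lt_or_gt_of_ne hy.1 with h | h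
      · refine le_add_left (le_of_eq ?_)
        rw [hH, Set.indicator_of_mem (show -y ∈ Set.Ioc (0 : ℝ) 2 from
          ⟨by linarith, by linarith [hmem.1]⟩), abs_of_neg h]
      · refine le_add_right (le_of_eq ?_)
        rw [hH, Set.indicator_of_mem (show y ∈ Set.Ioc (0 : ℝ) 2 from ⟨h, hmem.2⟩), abs_of_pos h]
    · rw [Set.indicator_of_notMem hmem]
      exact zero_le
  refine hle.trans_lt ?_
  rw [lintegral_add_left hHm, lintegral_neg_eq_self H]
  exact ENNReal.add_lt_top.2 ⟨hHfin, hHfin⟩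

/-- The singularities `|sin (φ - τ)|^(-3/4)` have uniformly bounded integrals. -/
theorem exists_lintegral_invPow_sin_le : ∃ B : ℝ, 0 < B ∧ ∀ τ : ℝ,
    ∫⁻ φ in Set.Ioo (-(Real.pi / 2)) (Real.pi / 2), invPow (3 / 4) |Real.sin (φ - τ)| ≤
      ENNReal.ofReal B := by
  refine ⟨(∫⁻ y in Set.Ioc (-2 : ℝ) 2, invPow (3 / 4) (|y| / 2)).toReal + 1, by positivity,
    fun τ => ?_⟩
  have hpi := Real.pi_pos
  have hpi4 := Real.pi_lt_four
  calc ∫⁻ φ in Set.Ioo (-(Real.pi / 2)) (Real.pi / 2), invPow (3 / 4) |Real.sin (φ - τ)|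
      ≤ ∫⁻ φ in Set.Ioc (-(Real.pi / 2)) (-(Real.pi / 2) + Real.pi),
          invPow (3 / 4) |Real.sin (φ - τ)| := by
        refine lintegral_mono_set fun y hy => ⟨hy.1, by linarith [hy.2]⟩
    -- The integrand has period π, so the window may be centred at its singularity.
    _ = ∫⁻ φ in Set.Ioc (τ - Real.pi / 2) (τ - Real.pi / 2 + Real.pi),
          invPow (3 / 4) |Real.sin (φ - τ)| := by
        refine (isAddFundamentalDomain_Ioc hpi _).setLIntegral_eq
          (isAddFundamentalDomain_Ioc hpi _) _ ?_
        rintro ⟨g, hg⟩ y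
        obtain ⟨n, rfl⟩ := AddSubgroup.mem_zmultiples_iff.1 hg
        congr 1
        have e : ((⟨n • Real.pi, hg⟩ : AddSubgroup.zmultiples Real.pi) +ᵥ y) - τ =
          (y - τ) + n * Real.pi := by
          rw [AddSubgroup.vadd_def]; simp; ring
        rw [e, Real.sin_add_int_mul_pi, abs_mul, abs_zpow]
        simp
    _ ≤ ∫⁻ φ, (Set.Ioc (-2 : ℝ) 2).indicator (fun y => invPow (3 / 4) (|y| / 2)) (φ - τ) := by
        rw [← lintegral_indicator measurableSet_Ioc]
        refine lintegral_mono fun φ => ?_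
        by_cases hφ : φ ∈ Set.Ioc (τ - Real.pi / 2) (τ - Real.pi / 2 + Real.pi)
        · have habs : |φ - τ| ≤ Real.pi / 2 := abs_le.2 ⟨by linarith [hφ.1], by linarith [hφ.2]⟩
          rw [Set.indicator_of_mem hφ, Set.indicator_of_mem
            (show φ - τ ∈ Set.Ioc (-2 : ℝ) 2 from
              ⟨by linarith [(abs_le.1 habs).1], by linarith [(abs_le.1 habs).2]⟩)]
          refine invPow_anti (by norm_num) (by positivity)
            (le_trans ?_ (Real.mul_abs_le_abs_sin habs))
          have h1 : 1 / 2 ≤ 2 / Real.pi := by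
            rw [div_le_div_iff₀ two_pos hpi]; linarith
          nlinarith [abs_nonneg (φ - τ)]
        · rw [Set.indicator_of_notMem hφ]
          exact zero_le
    _ = ∫⁻ y in Set.Ioc (-2 : ℝ) 2, invPow (3 / 4) (|y| / 2) := by
        rw [lintegral_sub_right_eq_self
          (fun φ => (Set.Ioc (-2 : ℝ) 2).indicator (fun y => invPow (3 / 4) (|y| / 2)) φ) τ,
          lintegral_indicator measurableSet_Ioc]
    _ ≤ _ := by
        rw [ENNReal.le_ofReal_iff_toReal_le lintegral_invPow_abs_lt_top.ne (by positivity)]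
        linarith

/-- The identity sin² α - sin² ψ = -sin(ψ - α) sin(ψ + α) with sin α = R/d; the directions ψ = ±α
are the two tangents to the disc. -/
theorem cross_sq_eq_of_sin {d ψ : ℝ} {R v' W : ℝ} (hd : 0 < d) (hR : 0 < R) (hRd : R ≤ d)
    (hv : v' ^ 2 = W ^ 2 * (1 - (d * Real.sin ψ / R) ^ 2)) :
    v' ^ 2 * (R / d) ^ 2 =
      W ^ 2 * (Real.sin (ψ - Real.arcsin (R / d)) * -Real.sin (ψ + Real.arcsin (R / d))) := by
  have h1 : Real.sin (Real.arcsin (R / d)) = R / d :=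
    Real.sin_arcsin (by have : 0 < R / d := by positivity
                        linarith) ((div_le_one hd).2 hRd)
  have h2 : Real.cos (Real.arcsin (R / d)) ^ 2 = 1 - (R / d) ^ 2 := by
    have := Real.sin_sq_add_cos_sq (Real.arcsin (R / d))
    rw [h1] at this
    linarith
  have h3 := Real.sin_sq_add_cos_sq ψ
  rw [Real.sin_sub, Real.sin_add, hv, h1]
  have h4 : (Real.sin ψ * Real.cos (Real.arcsin (R / d)) - Real.cos ψ * (R / d)) *
      -(Real.sin ψ * Real.cos (Real.arcsin (R / d)) + Real.cos ψ * (R / d)) =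
      (R / d) ^ 2 * Real.cos ψ ^ 2 - Real.sin ψ ^ 2 * Real.cos (Real.arcsin (R / d)) ^ 2 := by ring
  rw [h4, h2]
  have h5 : Real.cos ψ ^ 2 = 1 - Real.sin ψ ^ 2 := by linarith
  rw [h5]
  field_simp
  ring

/-- The normal speed at a collision is bounded below by the distance to the two tangential
directions. -/
theorem normal_speed_lower_bound {d ψ R v' W m : ℝ} (hd : 0 < d) (hR : 0 < R) (hRd : R ≤ d)
    (hm : 0 < m) (hv' : 0 ≤ v') (hmR : m ≤ R / d) (hmd : R ^ 2 + (m * d) ^ 2 ≤ d ^ 2)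
    (hcos : 0 < Real.cos ψ) (hv : v' ^ 2 = W ^ 2 * (1 - (d * Real.sin ψ / R) ^ 2))
    (hsin : |d * Real.sin ψ| ≤ R) :
    W * m * |Real.sin (ψ - Real.arcsin (R / d))| ^ (1 / 2 : ℝ) ≤ v' ∨
      W * m * |Real.sin (ψ + Real.arcsin (R / d))| ^ (1 / 2 : ℝ) ≤ v' := by
  set α := Real.arcsin (R / d) with hα
  have h1 : Real.sin α = R / d :=
    Real.sin_arcsin (by have : 0 < R / d := by positivity
                        linarith) ((div_le_one hd).2 hRd)
  have hkey := cross_sq_eq_of_sin hd hR hRd hv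
  rw [← hα] at hkey
  have hmcos : m ≤ Real.cos ψ := by
    refine le_of_sq_le_sq ?_ hcos.le
    have h3 := Real.sin_sq_add_cos_sq ψ
    have h4 : (d * Real.sin ψ) ^ 2 ≤ R ^ 2 := sq_le_sq' (abs_le.1 hsin).1 (abs_le.1 hsin).2
    have hd2 : 0 < d ^ 2 := by positivity
    refine le_of_mul_le_mul_left ?_ hd2
    nlinarith
  have hprod : v' ^ 2 * (R / d) ^ 2 = W ^ 2 * (|Real.sin (ψ - α)| * |Real.sin (ψ + α)|) := by
    have := congrArg abs hkey
    rwa [abs_of_nonneg (by positivity), abs_mul, abs_of_nonneg (sq_nonneg W), abs_mul, abs_neg]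
      at this
  have hR1 : (R / d) ^ 2 ≤ 1 := pow_le_one₀ (by positivity) ((div_le_one hd).2 hRd)
  have hle : W ^ 2 * (|Real.sin (ψ - α)| * |Real.sin (ψ + α)|) ≤ v' ^ 2 := by
    rw [← hprod]; nlinarith [sq_nonneg v']
  -- The two factors cannot both be small, since their difference is `2 cos ψ sin α`. One is at
  -- least `m²`, and the other enters under a square root.
  have hsum : 2 * m ^ 2 ≤ |Real.sin (ψ - α)| + |Real.sin (ψ + α)| := by
    have h5 : Real.sin (ψ + α) - Real.sin (ψ - α) = 2 * (Real.cos ψ * (R / d)) := by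
      rw [Real.sin_add, Real.sin_sub, h1]; ring
    have h6 : m * m ≤ Real.cos ψ * (R / d) := by gcongr
    have h7 := le_abs_self (Real.sin (ψ + α))
    have h8 := neg_abs_le (Real.sin (ψ - α))
    nlinarith
  have hfin : ∀ A B : ℝ, 0 ≤ A → m ^ 2 ≤ B → W ^ 2 * (A * B) ≤ v' ^ 2 →
      W * m * A ^ (1 / 2 : ℝ) ≤ v' := by
    intro A B hA hB h
    rw [← Real.sqrt_eq_rpow]
    refine le_of_sq_le_sq ?_ hv'
    rw [mul_pow, mul_pow, Real.sq_sqrt hA]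
    calc W ^ 2 * m ^ 2 * A = W ^ 2 * (A * m ^ 2) := by ring
      _ ≤ W ^ 2 * (A * B) := by gcongr
      _ ≤ _ := h
  rcases le_total (m ^ 2) |Real.sin (ψ + α)| with h | h
  · exact Or.inl (hfin _ _ (abs_nonneg _) h hle)
  · refine Or.inr (hfin _ |Real.sin (ψ - α)| (abs_nonneg _) (by linarith) ?_)
    rwa [mul_comm |Real.sin (ψ + α)|]

theorem finite_reachable (M : ℝ) :
    ∃ I : Finset (Fin p × ℤ × ℤ), ∀ (r : BoundaryPoint p) k,
      ‖T.discCenter k - T.lift r‖ ≤ M → k ∈ I := by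
  obtain ⟨a, B, ha, -, hB⟩ := T.exists_radius_bounds
  obtain ⟨C, -, hC⟩ := T.exists_norm_center_le
  refine ⟨(T.finite_discCenter_norm_le (M + (C + B))).toFinset, fun r k h => ?_⟩
  rw [Set.Finite.mem_toFinset, Set.mem_ofPred_eq]
  have e : T.discCenter k =
    (T.discCenter k - T.lift r) + (T.center r.1 + T.radius r.1 * (r.2 : ℂ)) := by
    rw [lift]; ring
  rw [e]
  refine (norm_add_le _ _).trans (add_le_add h ((norm_add_le _ _).trans (add_le_add (hC _) ?_)))
  rw [norm_mul, Circle.norm_coe, mul_one, Complex.norm_real,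
    Real.norm_of_nonneg (T.radius_pos _).le]
  exact (hB _).2

/-- Multiplication by the conjugate of the normal turns the normal into the real axis, so the
argument is the direction of `X` measured from the normal, as `φ` is. -/
theorem polar_outVelocityAngle (X : ℂ) (x : PhaseSpace p) (φ : ℝ) :
    cross X (outVelocityAngle x φ) = x.2 / Real.cos φ *
        (‖X‖ * Real.sin (φ - Complex.arg (X * (starRingEnd ℂ) (x.1.2 : ℂ)))) ∧
      inner ℝ X (outVelocityAngle x φ) = x.2 / Real.cos φ *
        (‖X‖ * Real.cos (φ - Complex.arg (X * (starRingEnd ℂ) (x.1.2 : ℂ)))) := by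
  set Y := X * (starRingEnd ℂ) (x.1.2 : ℂ) with hY
  have hn := circle_re_sq_add_im_sq x.1.2
  have hYn : ‖Y‖ = ‖X‖ := by rw [hY, norm_mul, RCLike.norm_conj, Circle.norm_coe, mul_one]
  have hre : Y.re = ‖X‖ * Real.cos (Complex.arg Y) := by rw [← hYn, Complex.norm_mul_cos_arg]
  have him : Y.im = ‖X‖ * Real.sin (Complex.arg Y) := by rw [← hYn, Complex.norm_mul_sin_arg]
  have hre' : Y.re = X.re * (x.1.2 : ℂ).re + X.im * (x.1.2 : ℂ).im := by
    rw [hY]; simp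
  have him' : Y.im = X.im * (x.1.2 : ℂ).re - X.re * (x.1.2 : ℂ).im := by
    rw [hY]; simp; ring
  rw [Real.sin_sub, Real.cos_sub]
  have e1 : ‖X‖ * (Real.sin φ * Real.cos Y.arg - Real.cos φ * Real.sin Y.arg) =
      Real.sin φ * Y.re - Real.cos φ * Y.im := by rw [hre, him]; ring
  have e2 : ‖X‖ * (Real.cos φ * Real.cos Y.arg + Real.sin φ * Real.sin Y.arg) =
      Real.cos φ * Y.re + Real.sin φ * Y.im := by rw [hre, him]; ring
  rw [e1, e2, hre', him', outVelocityAngle, Complex.exp_mul_I, ← Complex.ofReal_cos,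
    ← Complex.ofReal_sin, cross_eq_re_im, inner_eq_re_im]
  simp only [Complex.add_re, Complex.add_im, Complex.mul_re, Complex.mul_im, Complex.ofReal_re,
    Complex.ofReal_im, Complex.I_re, Complex.I_im]
  constructor <;> ring

/-- Pointwise bound for the reciprocal of the normal speed at the next collision. -/
theorem exists_inv_normal_speed_le (hT : T.BoundedHorizon) :
    ∃ (D : ℝ) (I : Finset (Fin p × ℤ × ℤ)), 0 < D ∧ ∀ x : PhaseSpace p, 0 < x.2 →
      ∃ τ τ' : Fin p × ℤ × ℤ → ℝ, ∀ φ ∈ Set.Ioo (-(Real.pi / 2)) (Real.pi / 2),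
        ((T.nextState x.1 (outVelocityAngle x φ)).2 : ENNReal)⁻¹ ≤
          ∑ k ∈ I, ENNReal.ofReal (D * (Real.cos φ / x.2)) *
            (invPow (1 / 2) |Real.sin (φ - τ k)| + invPow (1 / 2) |Real.sin (φ - τ' k)|) := by
  obtain ⟨g, M, hG⟩ := T.exists_geometryBounds hT
  have hg := hG.pos
  have hM := hG.bound_pos
  obtain ⟨I, hI⟩ := T.finite_reachable M
  refine ⟨M / g, I, by positivity, fun x hx => ?_⟩
  have hx' : (0 : ℝ) < x.2 := hx
  set z := T.lift x.1
  let Θ : Fin p × ℤ × ℤ → ℝ := fun k =>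
    Complex.arg ((T.discCenter k - z) * (starRingEnd ℂ) (x.1.2 : ℂ))
  let α : Fin p × ℤ × ℤ → ℝ := fun k =>
    Real.arcsin (T.radius k.1 / ‖T.discCenter k - z‖)
  refine ⟨fun k => Θ k + α k, fun k => Θ k - α k, fun φ hφ => ?_⟩
  have hcosφ := Real.cos_pos_of_mem_Ioo hφ
  have hw := outVelocityAngle_eq x hcosφ.ne'
  have hw0 : outVelocityAngle x φ ≠ 0 := hw ▸ outVelocity_ne_zero hx _
  obtain ⟨t, k, h, -, hk⟩ := T.firstHit_outVelocity hT hx (x.2 * Real.tan φ)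
  rw [← hw] at h
  have hX := hG.flight _ _ _ _ _ hw0 h
  have hXg := T.radius_add_le_norm_sub_lift hG.gap x.1 hk
  have hR := T.radius_pos k.1
  have hRg := hG.two_mul_le_radius k.1
  obtain ⟨hc, hi⟩ := polar_outVelocityAngle (T.discCenter k - z) x φ
  set d := ‖T.discCenter k - z‖ with hd
  set W : ℝ := x.2 / Real.cos φ with hWdef
  have hW : 0 < W := by positivity
  have hd0 : 0 < d := by linarith
  have hnorm : ‖outVelocityAngle x φ‖ = W := by
    rw [outVelocityAngle, norm_mul, norm_mul, Circle.norm_coe, Complex.norm_exp_ofReal_mul_I,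
      Complex.norm_real, Real.norm_of_nonneg hW.le, mul_one, mul_one]
  have hcr := h.abs_cross_center_le
  rw [hc, hnorm, abs_mul, abs_of_pos hW, mul_comm (T.radius k.1)] at hcr
  have hip := h.inner_center_pos hw0
  rw [hi] at hip
  have hsq := T.nextState_snd_sq h
  rw [hc, hnorm] at hsq
  have hmain := normal_speed_lower_bound (d := d) (ψ := φ - Θ k) (R := T.radius k.1)
    (v' := ((T.nextState x.1 (outVelocityAngle x φ)).2 : ℝ)) (W := W) (m := g / M) hd0 hR
    (by linarith) (by positivity) (NNReal.coe_nonneg _)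
    (by rw [div_le_div_iff₀ hM hd0]
        exact mul_le_mul (by linarith) hX hd0.le hR.le)
    (by have h1 : g / M * d ≤ g := by
          rw [div_mul_eq_mul_div, div_le_iff₀ hM]
          exact mul_le_mul_of_nonneg_left hX hg.le
        have h2 : (g / M * d) ^ 2 ≤ g ^ 2 := by gcongr
        have h3 : (T.radius k.1 + g) ^ 2 ≤ d ^ 2 := by gcongr
        have h4 : 0 < T.radius k.1 * g := by positivity
        nlinarith)
    (pos_of_mul_pos_right (pos_of_mul_pos_right hip hW.le) hd0.le)
    (by rw [hsq]; ring)
    (le_of_mul_le_mul_left hcr hW)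
  have hinv : ∀ A : ℝ, 0 ≤ A →
      W * (g / M) * A ^ (1 / 2 : ℝ) ≤ (T.nextState x.1 (outVelocityAngle x φ)).2 →
      ((T.nextState x.1 (outVelocityAngle x φ)).2 : ENNReal)⁻¹ ≤
        ENNReal.ofReal (M / g * (Real.cos φ / x.2)) * invPow (1 / 2) A := by
    intro A hA hle
    have e : ENNReal.ofReal (M / g * (Real.cos φ / x.2)) =
        (ENNReal.ofReal (W * (g / M)))⁻¹ := by
      rw [← ENNReal.ofReal_inv_of_pos (by positivity), hWdef]
      congr 1
      field_simp
    rw [e, invPow, ← ENNReal.mul_inv (Or.inr ENNReal.ofReal_ne_top)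
      (Or.inl ENNReal.ofReal_ne_top), ← ENNReal.ofReal_mul (by positivity),
      ← ENNReal.ofReal_coe_nnreal]
    gcongr
  -- The disc that is hit varies with `φ`; summing over all reachable discs removes this dependence.
  refine le_trans ?_ (Finset.single_le_sum (fun _ _ => zero_le) (hI x.1 k hX))
  rw [mul_add]
  rcases hmain with h1 | h1
  · refine le_add_right ?_
    rw [← sub_sub]
    exact hinv _ (abs_nonneg _) h1
  · refine le_add_left ?_
    have e : φ - (Θ k - α k) = φ - Θ k + α k := by ring
    rw [e]
    exact hinv _ (abs_nonneg _) h1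

theorem mul_exp_neg_sq_le_one (y : ℝ) : y * Real.exp (-y ^ 2) ≤ 1 := by
  rw [Real.exp_neg, ← div_eq_mul_inv, div_le_one (Real.exp_pos _)]
  nlinarith [Real.add_one_le_exp (y ^ 2), sq_nonneg (y - 1), sq_nonneg y]

/-- The density of the angle, divided by the speed, has an integrable singularity. -/
theorem exp_tan_div_cos_le {b v φ : ℝ} (hb : 0 < b) (hv : 0 < v)
    (hφ : φ ∈ Set.Ioo (-(Real.pi / 2)) (Real.pi / 2)) :
    Real.exp (-b * v ^ 2 * Real.tan φ ^ 2) / Real.cos φ ≤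
      (1 + 1 / (√b * v)) ^ (3 / 4 : ℝ) * (Real.cos φ ^ (1 / 4 : ℝ))⁻¹ := by
  have hcos := Real.cos_pos_of_mem_Ioo hφ
  set h := Real.exp (-b * v ^ 2 * Real.tan φ ^ 2) / Real.cos φ with hh
  have hh0 : 0 < h := by positivity
  have hb' : 0 < √b := Real.sqrt_pos.2 hb
  have hexp : Real.exp (-b * v ^ 2 * Real.tan φ ^ 2) ≤ 1 := by
    rw [Real.exp_le_one_iff]
    have : 0 ≤ b * v ^ 2 * Real.tan φ ^ 2 := by positivity
    linarith
  have h1 : h ≤ (Real.cos φ)⁻¹ := by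
    rw [hh, div_eq_mul_inv]
    exact mul_le_of_le_one_left (by positivity) hexp
  have h2 : h ≤ 1 + 1 / (√b * v) := by
    have h3 : (Real.cos φ)⁻¹ ≤ 1 + |Real.tan φ| := by
      refine le_of_sq_le_sq ?_ (by positivity)
      rw [inv_pow, ← Real.inv_one_add_tan_sq hcos.ne', inv_inv]
      nlinarith [abs_nonneg (Real.tan φ), sq_abs (Real.tan φ)]
    have h4 : |Real.tan φ| * Real.exp (-b * v ^ 2 * Real.tan φ ^ 2) ≤ 1 / (√b * v) := by
      rw [le_div_iff₀ (by positivity)]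
      have h5 := mul_exp_neg_sq_le_one (√b * v * |Real.tan φ|)
      have e : -(√b * v * |Real.tan φ|) ^ 2 = -b * v ^ 2 * Real.tan φ ^ 2 := by
        rw [mul_pow, mul_pow, Real.sq_sqrt hb.le, sq_abs]; ring
      rw [e] at h5
      linarith
    calc h = Real.exp (-b * v ^ 2 * Real.tan φ ^ 2) * (Real.cos φ)⁻¹ := by rw [hh, div_eq_mul_inv]
      _ ≤ Real.exp (-b * v ^ 2 * Real.tan φ ^ 2) * (1 + |Real.tan φ|) := by gcongr
      _ ≤ _ := by linarith
  -- Interpolation between the bounds `h2` and `h1`: the power of `1/v` stays below 1, and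
  -- `cos^(-1/4)` leaves room for a singularity of order 1/2.
  calc h = h ^ (3 / 4 : ℝ) * h ^ (1 / 4 : ℝ) := by
        rw [← Real.rpow_add hh0]; norm_num
    _ ≤ (1 + 1 / (√b * v)) ^ (3 / 4 : ℝ) * ((Real.cos φ)⁻¹) ^ (1 / 4 : ℝ) := by gcongr
    _ = _ := by rw [Real.inv_rpow hcos.le]

theorem rpow_three_quarters_le {Y δ : ℝ} (hY : 0 < Y) (hδ : 0 < δ) :
    Y ^ (3 / 4 : ℝ) ≤ δ * Y + δ⁻¹ ^ 3 := by
  set q := Y ^ (1 / 4 : ℝ) with hq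
  have hq0 : 0 < q := by positivity
  have h3 : Y ^ (3 / 4 : ℝ) = q ^ 3 := by
    rw [hq, ← Real.rpow_natCast, ← Real.rpow_mul hY.le]; norm_num
  have h4 : Y = q ^ 4 := by
    rw [hq, ← Real.rpow_natCast, ← Real.rpow_mul hY.le]; norm_num
  rw [h3, h4]
  rcases le_total q δ⁻¹ with h | h
  · have : q ^ 3 ≤ δ⁻¹ ^ 3 := by gcongr
    have : 0 < δ * q ^ 4 := by positivity
    linarith
  · have h5 : 1 ≤ δ * q := by
      rwa [inv_le_iff_one_le_mul₀ hδ, mul_comm] at h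
    have : 0 < δ⁻¹ ^ 3 := by positivity
    have : q ^ 3 * 1 ≤ q ^ 3 * (δ * q) := by gcongr
    nlinarith

/-- The drift condition for the potential `1 / v⊥`. -/
theorem exists_lintegral_inv_le (hT : T.BoundedHorizon) : ∃ K : ℝ, 0 < K ∧
    ∀ x : PhaseSpace p, 0 < x.2 → ∫⁻ φ in Set.Ioo (-(Real.pi / 2)) (Real.pi / 2),
      ((T.nextState x.1 (outVelocityAngle x φ)).2 : ENNReal)⁻¹ *
        ENNReal.ofReal (angleDensity (T.beta x.1.1) (x.2 : ℝ) φ) ≤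
      ENNReal.ofReal (1 / 2 * (x.2 : ℝ)⁻¹ + K) := by
  obtain ⟨D, I, hD, hpt⟩ := T.exists_inv_normal_speed_le hT
  obtain ⟨B, hB, hsing⟩ := exists_lintegral_invPow_sin_le
  have hS : ∀ᶠ S in Filter.atTop, ∀ i, √(T.beta i / Real.pi) ≤ S :=
    Filter.eventually_all.2 fun i => Filter.eventually_ge_atTop _
  obtain ⟨S, hS, hS0⟩ := (hS.and (Filter.eventually_gt_atTop 0)).exists
  have hb : ∀ᶠ b in nhdsWithin (0 : ℝ) (Set.Ioi 0), ∀ i, b ≤ √(T.beta i) :=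
    Filter.eventually_all.2 fun i => (Filter.eventually_of_mem
      (Ioc_mem_nhdsGT (Real.sqrt_pos.2 (T.beta_pos i))) fun _ h => h.2)
  obtain ⟨b, hb, hb0⟩ := (hb.and self_mem_nhdsWithin).exists
  replace hb0 : 0 < b := hb0
  set E := D * S * (I.card * (4 * B)) + 1 with hE
  have hE0 : 0 < E := by positivity
  -- Makes `E * δ / (b * v)` equal to `1 / (2 * v)`.
  set δ := b / (2 * E) with hδ
  have hδ0 : 0 < δ := by positivity
  refine ⟨E * (δ + δ⁻¹ ^ 3), by positivity, fun x hx => ?_⟩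
  have hv : (0 : ℝ) < x.2 := hx
  obtain ⟨τ, τ', hτ⟩ := hpt x hx
  set β := T.beta x.1.1 with hβdef
  have hβ : 0 < β := T.beta_pos _
  set v : ℝ := ((x.2 : NNReal) : ℝ) with hvdef
  set Y := 1 + 1 / (√β * v) with hY
  have hβ' : 0 < √β := Real.sqrt_pos.2 hβ
  have hY0 : 0 < Y := by positivity
  have hbound : ∀ φ ∈ Set.Ioo (-(Real.pi / 2)) (Real.pi / 2),
      ((T.nextState x.1 (outVelocityAngle x φ)).2 : ENNReal)⁻¹ *
        ENNReal.ofReal (angleDensity β v φ) ≤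
      ENNReal.ofReal (D * S * Y ^ (3 / 4 : ℝ)) * ∑ k ∈ I,
        (2 * invPow (3 / 4) |Real.sin (φ - -(Real.pi / 2))| +
          (invPow (3 / 4) |Real.sin (φ - τ k)| + invPow (3 / 4) |Real.sin (φ - τ' k)|)) := by
    intro φ hφ
    have hcos := Real.cos_pos_of_mem_Ioo hφ
    -- The cosine singularity is thereby covered by the same uniform sine bound.
    have hsin : |Real.sin (φ - -(Real.pi / 2))| = Real.cos φ := by
      rw [sub_neg_eq_add, Real.sin_add_pi_div_two, abs_of_pos hcos]
    have h1 : ENNReal.ofReal (D * (Real.cos φ / v)) * ENNReal.ofReal (angleDensity β v φ) ≤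
        ENNReal.ofReal (D * S * Y ^ (3 / 4 : ℝ)) * invPow (1 / 4) (Real.cos φ) := by
      rw [invPow, ← ENNReal.ofReal_inv_of_pos (by positivity), ← ENNReal.ofReal_mul (by positivity),
        ← ENNReal.ofReal_mul (by positivity)]
      refine ENNReal.ofReal_le_ofReal ?_
      have e : D * (Real.cos φ / v) * angleDensity β v φ = D * √(β / Real.pi) *
          (Real.exp (-β * v ^ 2 * Real.tan φ ^ 2) / Real.cos φ) := by
        rw [angleDensity]; field_simp
      rw [e, mul_assoc (D * S)]
      gcongr
      · exact hS _
      · exact exp_tan_div_cos_le hβ hv hφ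
    refine (mul_le_mul_left (hτ φ hφ) _).trans ?_
    rw [← Finset.mul_sum, mul_right_comm, Finset.mul_sum, Finset.mul_sum]
    refine Finset.sum_le_sum fun k _ => (mul_le_mul_left h1 _).trans ?_
    rw [mul_assoc, hsin]
    refine mul_le_mul_right ?_ _
    rw [mul_add]
    have h2 : ∀ A : ℝ, invPow (1 / 4) (Real.cos φ) * invPow (1 / 2) |A| ≤
        invPow (3 / 4) (Real.cos φ) + invPow (3 / 4) |A| := fun A => by
      have := invPow_mul_invPow_le (s := 1 / 4) (s' := 1 / 2) (by norm_num) (by norm_num) hcos.le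
        (abs_nonneg A)
      norm_num at this ⊢
      exact this
    refine (add_le_add (h2 _) (h2 _)).trans (le_of_eq ?_)
    ring
  have hmeas : ∀ s : ℝ, Measurable fun φ => invPow (3 / 4) |Real.sin (φ - s)| := fun s => by
    unfold invPow; fun_prop
  refine (setLIntegral_mono (by fun_prop) hbound).trans ?_
  rw [lintegral_const_mul _ (by fun_prop), lintegral_finsetSum _ (fun k _ => by fun_prop)]
  have hk : ∀ k ∈ I, ∫⁻ φ in Set.Ioo (-(Real.pi / 2)) (Real.pi / 2),
      (2 * invPow (3 / 4) |Real.sin (φ - -(Real.pi / 2))| +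
        (invPow (3 / 4) |Real.sin (φ - τ k)| + invPow (3 / 4) |Real.sin (φ - τ' k)|)) ≤
      ENNReal.ofReal (4 * B) := by
    intro k _
    rw [lintegral_add_left (by fun_prop), lintegral_add_left (by fun_prop),
      lintegral_const_mul _ (by fun_prop)]
    have e : ENNReal.ofReal (4 * B) = 2 * ENNReal.ofReal B +
        (ENNReal.ofReal B + ENNReal.ofReal B) := by
      rw [ENNReal.ofReal_mul (by norm_num)]; norm_num; ring
    rw [e]
    gcongr <;> exact hsing _
  have hsum := Finset.sum_le_sum hk
  rw [Finset.sum_const, nsmul_eq_mul, ← ENNReal.ofReal_natCast,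
    ← ENNReal.ofReal_mul (by positivity)] at hsum
  refine (mul_le_mul_right hsum _).trans ?_
  rw [← ENNReal.ofReal_mul (by positivity)]
  refine ENNReal.ofReal_le_ofReal ?_
  have h1 : D * S * Y ^ (3 / 4 : ℝ) * (I.card * (4 * B)) ≤ E * Y ^ (3 / 4 : ℝ) := by
    have : 0 < Y ^ (3 / 4 : ℝ) := by positivity
    rw [hE]; nlinarith
  have h2 := mul_le_mul_of_nonneg_left (rpow_three_quarters_le hY0 hδ0) hE0.le
  have h3 : E * (δ * (1 / (√β * v))) ≤ 1 / 2 * v⁻¹ := by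
    have h4 : 1 / (√β * v) ≤ 1 / (b * v) := by
      gcongr; exact hb _
    calc E * (δ * (1 / (√β * v))) ≤ E * (δ * (1 / (b * v))) := by gcongr
      _ = 1 / 2 * v⁻¹ := by rw [hδ]; field_simp
  have h5 : δ * Y = δ + δ * (1 / (√β * v)) := by rw [hY]; ring
  rw [h5] at h2
  linarith

/-! ### Comparison with the potential and conclusion -/

theorem potential_le (ε vmin vmax A : ℝ) (y : PhaseSpace p) :
    potential ε vmin vmax A y ≤ (y.2 : ENNReal)⁻¹ +
      (ENNReal.ofReal A + ENNReal.ofReal (Real.exp (ε * (y.2 : ℝ) ^ 2))) := by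
  unfold potential
  split_ifs
  · exact le_self_add
  · exact le_add_left le_self_add
  · exact le_add_left le_add_self

/-- Both singular functions are dominated by the potential, up to a constant. -/
theorem inv_add_exp_le_potential {ε γ vmin vmax A K : ℝ} (hε : 0 < ε) (hγ : 1 / 2 ≤ γ)
    (hγ1 : γ ≤ 1) (hmin : 0 < vmin) (hmax : vmin < vmax) (hK : 0 ≤ K) {x : PhaseSpace p}
    (hx : 0 < x.2) :
    ENNReal.ofReal (1 / 2 * (x.2 : ℝ)⁻¹ + γ * Real.exp (ε * (x.2 : ℝ) ^ 2) + K) ≤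
      ENNReal.ofReal γ * potential ε vmin vmax A x +
        ENNReal.ofReal (1 / 2 * vmin⁻¹ + Real.exp (ε * vmax ^ 2) + K) := by
  have hv : (0 : ℝ) < x.2 := hx
  have hγ0 : 0 < γ := by linarith
  have hexp : 0 < Real.exp (ε * vmax ^ 2) := Real.exp_pos _
  have hexp' : (x.2 : ℝ) ≤ vmax →
      γ * Real.exp (ε * (x.2 : ℝ) ^ 2) ≤ Real.exp (ε * vmax ^ 2) := fun h => by
    have h1 : Real.exp (ε * (x.2 : ℝ) ^ 2) ≤ Real.exp (ε * vmax ^ 2) := by gcongr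
    nlinarith [Real.exp_pos (ε * (x.2 : ℝ) ^ 2)]
  have hinv' : vmin ≤ x.2 → 1 / 2 * (x.2 : ℝ)⁻¹ ≤ 1 / 2 * vmin⁻¹ := fun h => by gcongr
  have hmin' : 0 < vmin⁻¹ := by positivity
  unfold potential
  split_ifs with h1 h2
  · rw [← ENNReal.ofReal_coe_nnreal, ← ENNReal.ofReal_inv_of_pos hv,
      ← ENNReal.ofReal_mul hγ0.le, ← ENNReal.ofReal_add (by positivity) (by positivity)]
    refine ENNReal.ofReal_le_ofReal ?_
    have h3 : 1 / 2 * (x.2 : ℝ)⁻¹ ≤ γ * (x.2 : ℝ)⁻¹ := by gcongr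
    linarith [hexp' (h1.le.trans hmax.le)]
  · refine le_add_left (ENNReal.ofReal_le_ofReal ?_)
    linarith [hexp' h2, hinv' (not_lt.1 h1)]
  · rw [← ENNReal.ofReal_mul hγ0.le, ← ENNReal.ofReal_add (by positivity) (by positivity)]
    refine ENNReal.ofReal_le_ofReal ?_
    linarith [hinv' (not_lt.1 h1)]

theorem lintegral_gaussDensity {β : ℝ} (hβ : 0 < β) : ∫⁻ u, gaussDensity β u = 1 := by
  have := lintegral_gaussDensity_mul_exp hβ hβ 0 0
  simpa [gaussDensity, div_self hβ.ne'] using this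

end ThermostatTable

theorem proposition4p1 {p : ℕ} (T : ThermostatTable p) (hT : T.BoundedHorizon) :
    ∃ ε vmin vmax A γ K : ℝ,
      0 < ε ∧ (∀ i, ε < T.beta i) ∧
      0 < vmin ∧ vmin < vmax ∧ Real.exp (ε * vmax ^ 2) = A ∧ vmin⁻¹ = A ∧
      0 < γ ∧ γ < 1 ∧ 0 < K ∧
      (∀ x : PhaseSpace p,
        T.pullback (ThermostatTable.potential ε vmin vmax A) x ≤
          ENNReal.ofReal γ * ThermostatTable.potential ε vmin vmax A x + ENNReal.ofReal K) ∧
      (∀ x : PhaseSpace p, 0 < x.2 →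
        T.pullback (ThermostatTable.potential ε vmin vmax A) x =
          ∫⁻ φ in Set.Ioo (-(Real.pi / 2)) (Real.pi / 2),
            ThermostatTable.potential ε vmin vmax A
                (T.nextState x.1 (ThermostatTable.outVelocityAngle x φ)) *
              ENNReal.ofReal (ThermostatTable.angleDensity (T.beta x.1.1) (x.2 : ℝ) φ)) := by
  have hβ : ∀ᶠ ε in nhdsWithin (0 : ℝ) (Set.Ioi 0), ∀ i, ε < T.beta i :=
    Filter.eventually_all.2 fun i =>
      (Filter.eventually_of_mem (Ioo_mem_nhdsGT (T.beta_pos i)) fun _ h => h.2)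
  obtain ⟨ε', hε'β, hε'⟩ := (hβ.and self_mem_nhdsWithin).exists
  replace hε' : 0 < ε' := hε'
  obtain ⟨ε, hε, hεε'⟩ := exists_between hε'
  obtain ⟨γ₁, K₁, hγ₁0, hγ₁1, hK₁, hexp⟩ := T.exists_lintegral_exp_le hT hε hεε' hε'β
  obtain ⟨K₂, hK₂, hinv⟩ := T.exists_lintegral_inv_le hT
  -- With `vmax = 1`, the matching conditions force `A = exp ε` and `vmin = A⁻¹ < 1`.
  set A := Real.exp ε with hA
  have hA0 : 0 < A := Real.exp_pos _
  set γ := max (1 / 2) γ₁ with hγ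
  have hγ1 : γ < 1 := max_lt (by norm_num) hγ₁1
  have hmax : A⁻¹ < 1 := inv_lt_one_of_one_lt₀ (Real.one_lt_exp_iff.2 hε)
  refine ⟨ε, A⁻¹, 1, A, γ, 1 / 2 * (A⁻¹)⁻¹ + Real.exp (ε * 1 ^ 2) + (K₁ + K₂ + A), hε,
    fun i => hεε'.trans (hε'β i), by positivity, hmax, by simp [hA], inv_inv A,
    lt_max_of_lt_left (by norm_num), hγ1, by positivity, fun x => ?_, fun x hx =>
    T.pullback_eq_lintegral_angle hT hx (ThermostatTable.measurable_potential _ _ _ _)⟩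
  rcases eq_or_lt_of_le (zero_le (a := x.2)) with h0 | hx
  · have : ThermostatTable.potential ε A⁻¹ 1 A x = ⊤ := by
      simp [ThermostatTable.potential, ← h0, hA0]
    -- At zero normal speed the right-hand side is infinite because `γ` is positive.
    rw [this, ENNReal.mul_top (by simp [hγ]), top_add]
    exact le_top
  · have hβ0 := T.beta_pos x.1.1
    have hmeas : Measurable fun u => T.nextState x.1 (ThermostatTable.outVelocity x u) :=
      T.measurable_nextState hT hx
    have hg := ThermostatTable.measurable_gaussDensity (T.beta x.1.1)
    have hf : Measurable fun y : PhaseSpace p => (y.2 : ENNReal)⁻¹ := by fun_prop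
    have hginv : Measurable fun u => ThermostatTable.gaussDensity (T.beta x.1.1) u *
        ((T.nextState x.1 (ThermostatTable.outVelocity x u)).2 : ENNReal)⁻¹ :=
      hg.mul (hf.comp hmeas)
    have hinv' : ∫⁻ u, ThermostatTable.gaussDensity (T.beta x.1.1) u *
        ((T.nextState x.1 (ThermostatTable.outVelocity x u)).2 : ENNReal)⁻¹ ≤
        ENNReal.ofReal (1 / 2 * (x.2 : ℝ)⁻¹ + K₂) := by
      rw [← T.pullback_eq_lintegral hT hx hf, T.pullback_eq_lintegral_angle hT hx hf]
      exact hinv x hx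
    rw [T.pullback_eq_lintegral hT hx (ThermostatTable.measurable_potential _ _ _ _)]
    calc _ ≤ ∫⁻ u, (ThermostatTable.gaussDensity (T.beta x.1.1) u *
            ((T.nextState x.1 (ThermostatTable.outVelocity x u)).2 : ENNReal)⁻¹ +
          (ThermostatTable.gaussDensity (T.beta x.1.1) u * ENNReal.ofReal A +
          ThermostatTable.gaussDensity (T.beta x.1.1) u * ENNReal.ofReal (Real.exp
            (ε * ((T.nextState x.1 (ThermostatTable.outVelocity x u)).2 : ℝ) ^ 2)))) := by
          refine lintegral_mono fun u => ?_
          rw [← mul_add, ← mul_add]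
          exact mul_le_mul_right (ThermostatTable.potential_le _ _ _ _ _) _
      _ ≤ ENNReal.ofReal (1 / 2 * (x.2 : ℝ)⁻¹ + K₂) + (ENNReal.ofReal A +
          ENNReal.ofReal (γ₁ * Real.exp (ε * (x.2 : ℝ) ^ 2) + K₁)) := by
          rw [lintegral_add_left hginv, lintegral_add_left (by fun_prop),
            lintegral_mul_const _ hg, ThermostatTable.lintegral_gaussDensity hβ0, one_mul]
          gcongr
          exact hexp x hx
      _ ≤ ENNReal.ofReal (1 / 2 * (x.2 : ℝ)⁻¹ + γ * Real.exp (ε * (x.2 : ℝ) ^ 2) +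
          (K₁ + K₂ + A)) := by
          rw [← ENNReal.ofReal_add (by positivity) (by positivity),
            ← ENNReal.ofReal_add (by positivity) (by positivity)]
          refine ENNReal.ofReal_le_ofReal ?_
          have : γ₁ * Real.exp (ε * (x.2 : ℝ) ^ 2) ≤ γ * Real.exp (ε * (x.2 : ℝ) ^ 2) := by
            gcongr; exact le_max_right _ _
          linarith
      _ ≤ _ := ThermostatTable.inv_add_exp_le_potential hε (le_max_left _ _) hγ1.le
          (by positivity) hmax (by positivity) hx
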